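/- Let $M\ge 1$, $\sigma^2>0$, $R>0$, $\mathcal P>0$, $\mathcal J>0$, and let $\mathfrak m$ be a probability measure on $\mathbb R_+^M$ that is absolutely continuous with respect to Lebesgue measure (the law of the vector $\mathbf h=(h_0,\dots,h_{M-1})$ of squared channel gains of a frame). For block powers $\mathbf P,\mathbf J\in\mathbb R_+^M$ of the transmitter and the jammer put $$I_M(\mathbf h,\mathbf P,\mathbf J)=\frac1M\sum_{m}\log\Bigl(1+\frac{h_mP_m}{\sigma^2+J_m}\Bigr),\qquad P_M=\frac1M\sum_m P_m,\qquad J_M=\frac1M\sum_m J_m .$$ A pure transmitter (jammer) strategy is a measurable map $\mathbf h\mapsto\mathbf P(\mathbf h)\in\mathbb R_+^M$ (resp. $\mathbf h\mapsto\mathbf J(\mathbf h)\in\mathbb R_+^M$) with $E[P_M(\mathbf h)]\le\mathcal P$ (resp. $E[J_M(\mathbf h)]\le\mathcal J$). For a jammer strategy $\mathbf J$ let $P_{out}(\mathbf J)$ be the infimum of $\mathfrak m(I_M(\mathbf h,\mathbf P(\mathbf h),\mathbf J(\mathbf h))<R)$ over all transmitter strategies $\mathbf P$; the jammer strategy is (maximin)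 optimal if it maximizes $P_{out}$ over all jammer strategies. The required power against $\mathbf J\in\mathbb R_+^M$ on a frame $\mathbf h$ is $\pi(\mathbf h,\mathbf J)=\inf\{P_M:\mathbf P\in\mathbb R_+^M,\ I_M(\mathbf h,\mathbf P,\mathbf J)\ge R\}$, and the characteristic curve of $\mathbf h$ is $\mathscr P_M(j,\mathbf h)=\sup\{\pi(\mathbf h,\mathbf J):\mathbf J\in\mathbb R_+^M,\ J_M\le j\}$, $j\ge0$. Its slope at $j$ is its right derivative in $j$. For $K\ge0$, a jammer strategy $\mathbf J$ is called a steepest-slope filling with level $K$ if * $E[J_M(\mathbf h)]=\mathcal J$; * $\pi(\mathbf h,\mathbf J(\mathbf h))=\mathscr P_M(J_M(\mathbf h),\mathbf h)$ for a.e. $\mathbf h$; * $\mathscr P_M(J_M(\mathbf h),\mathbf h)\le K$ for a.e. $\mathbf h$ with $J_M(\mathbf h)>0$; * for a.e. $\mathbf h_1$ and a.e. $\mathbf h_2$, if $\mathscr P_M(J_M(\mathbf h_1),\mathbf h_1)<K$, then for every $0\le j<J_M(\mathbf h_2)$ the slope of $\mathscr P_M(\cdot,\mathbf h_1)$ at $J_M(\mathbf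 h_1)$ is at most the slope of $\mathscr P_M(\cdot,\mathbf h_2)$ at $j$. **Theorem.** There is $K_{max}\in(0,\infty)$ such that: 1. there is a level $K\in[0,K_{max}]$ for which steepest-slope fillings with level $K$ exist and all of them are optimal jammer strategies (so it is optimal to meet the power constraint with equality); 2. every optimal jammer strategy $\mathbf J$ with $P_{out}(\mathbf J)>0$ is a steepest-slope filling with some level $K\in[0,K_{max}]$; 3. an optimal level can be found by exhaustive search in $[0,K_{max}]$: for every $\varepsilon>0$ there is $\delta>0$ such that every finite $G\subset[0,K_{max}]$ that meets $[x-\delta,x+\delta]$ for each $x\in[0,K_{max}]$ contains a level $K$ for which steepest-slope fillings with level $K$ exist and every such filling $\mathbf J$ satisfies $P_{out}(\mathbf J)\ge P_{out}(\mathbf J')-\varepsilon$ for all jammer strategies $\mathbf J'$. -/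

import Mathlib

open MeasureTheory Set

noncomputable section

namespace Jamming

/-- Average over the `M` blocks of a frame; for a power vector this is the frame power. -/
def frameMean {M : ℕ} (x : Fin M → ℝ) : ℝ :=
  (1 / (M : ℝ)) * ∑ m, x m

/-- Instantaneous mutual information `I_M` of a frame with squared channel gains `h`, transmitter
powers `P`, jammer powers `J` and ambient noise variance `N`. -/
def mutualInfo {M : ℕ} (N : ℝ) (h P J : Fin M → ℝ) : ℝ :=
  frameMean fun m => Real.log (1 + h m * P m / (N + J m))

/-- Least frame power with which the transmitter achieves `I_M ≥ R` against the block jamming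
powers `J`. The infimum is over a nonempty set bounded below as soon as `h` has a positive entry,
which is the case for almost every `h` under a law with a density. -/
def requiredPower {M : ℕ} (N R : ℝ) (h J : Fin M → ℝ) : ℝ :=
  sInf {p | ∃ P : Fin M → ℝ, (∀ m, 0 ≤ P m) ∧ R ≤ mutualInfo N h P J ∧ p = frameMean P}

/-- The characteristic curve `j ↦ 𝒫_M(j, h)` of the frame `h`: the largest required transmitter
power that the jammer can enforce by distributing the frame power `j` between the blocks. -/
def charCurve {M : ℕ} (N R : ℝ) (h : Fin M → ℝ) (j : ℝ) : ℝ :=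
  sSup {p | ∃ J : Fin M → ℝ, (∀ m, 0 ≤ J m) ∧ frameMean J ≤ j ∧ p = requiredPower N R h J}

/-- Instantaneous slope (right derivative) of the characteristic curve of `h` at jamming power `j`.
-/
def slope {M : ℕ} (N R : ℝ) (h : Fin M → ℝ) (j : ℝ) : ℝ :=
  derivWithin (charCurve N R h) (Ioi j) j

/-- A pure strategy with CSI: block powers as a function of the channel realization, with long-term
average power at most `B`. -/
structure IsStrategy {M : ℕ} (μ : Measure (Fin M → ℝ)) (B : ℝ)
    (A : (Fin M → ℝ) → Fin M → ℝ) : Prop where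
  measurable : Measurable A
  nonneg : ∀ h m, 0 ≤ A h m
  integrable : Integrable (fun h => frameMean (A h)) μ
  average_le : ∫ h, frameMean (A h) ∂μ ≤ B

/-- Outage probability `Pr(I_M < R)` of a pair of pure strategies. -/
def outage {M : ℕ} (μ : Measure (Fin M → ℝ)) (N R : ℝ)
    (P J : (Fin M → ℝ) → Fin M → ℝ) : ℝ :=
  μ.real {h | mutualInfo N h (P h) (J h) < R}

/-- Outage probability against the jammer strategy `J` when the transmitter, who knows `J` and has
average power `Pbar`, responds optimally. -/
def responseOutage {M : ℕ} (μ : Measure (Fin M → ℝ)) (N R Pbar : ℝ)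
    (J : (Fin M → ℝ) → Fin M → ℝ) : ℝ :=
  sInf {q | ∃ P : (Fin M → ℝ) → Fin M → ℝ, IsStrategy μ Pbar P ∧ q = outage μ N R P J}

/-- `J` is an optimal jammer strategy in the maximin (jammer-first) game. -/
def IsOptimalJammer {M : ℕ} (μ : Measure (Fin M → ℝ)) (N R Pbar Jbar : ℝ)
    (J : (Fin M → ℝ) → Fin M → ℝ) : Prop :=
  IsStrategy μ Jbar J ∧
    ∀ J', IsStrategy μ Jbar J' → responseOutage μ N R Pbar J' ≤ responseOutage μ N R Pbar J

/-- `J` spends the average power `Jbar` exactly by the steepest-slope-first rule with level `K`. -/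
structure IsSteepestFilling {M : ℕ} (μ : Measure (Fin M → ℝ)) (N R Jbar K : ℝ)
    (J : (Fin M → ℝ) → Fin M → ℝ) : Prop where
  strategy : IsStrategy μ Jbar J
  /-- The power constraint holds with equality. -/
  average_eq : ∫ h, frameMean (J h) ∂μ = Jbar
  /-- Inside each frame the power is distributed so that the required power is maximal. -/
  intra : ∀ᵐ h ∂μ, requiredPower N R h (J h) = charCurve N R h (frameMean (J h))
  /-- Where the jammer is present, the required power does not exceed `K`. -/
  level : ∀ᵐ h ∂μ, 0 < frameMean (J h) → charCurve N R h (frameMean (J h)) ≤ K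
  /-- Steepest slope first: if the frame `h₁` is still below the level `K`, then all power spent on
  any frame `h₂` was spent where its curve is at least as steep as that of `h₁` is now. -/
  steepest : ∀ᵐ h₁ ∂μ, ∀ᵐ h₂ ∂μ, charCurve N R h₁ (frameMean (J h₁)) < K →
    ∀ j, 0 ≤ j → j < frameMean (J h₂) → slope N R h₁ (frameMean (J h₁)) ≤ slope N R h₂ j

end Jamming

end

/-! The proof is a duality argument. Let p(h) be the power required on frame h against J(h). Any
transmitter response satisfies min(K, p) ≤ K·1_outage + P_M pointwise, so the outage is at least (E
min(K, p) − Pbar)/K for every K > 0 (`cappedPower_le_responseOutage`). Conversely, the transmitter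
serves the cheapest frames until the budget is spent; a law with a density lets it spend exactly
Pbar, and for the resulting threshold K the bound is an equality, unless every frame can be served
and the outage is 0 (`responseOutage_le_cappedPower`).

The jammer therefore maximizes (V(K) − Pbar)/K, where V(K) = `cappedValue` is the largest average of
the characteristic curves capped at K. For fixed K this is a concave allocation problem. It is
solved by a price l: every frame maximizes min(K, f(j)) − l·j, unless all curves are lifted to K.
The steepest-slope rule is the first-order condition of this problem, with l separating the slopes
still available below K from the slopes already used (`isSteepestFilling_iff`).

V is 1-Lipschitz, at most K, and sublinear, so a positive supremum of the quotient is attained in a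
compact interval. At a maximizer, lifting all frames to K must cost at least the available power:
otherwise a higher K' has V(K') = K', and (K' − Pbar)/K' is larger. Such feasible levels carry
fillings and are closed upwards, so a grid point just to the right of the maximizer is nearly
optimal. An optimal J turns all these inequalities into equalities for its own threshold K, which
forces it to be a filling. If the quotient is never positive, no strategy causes outage and any
feasible level serves. -/

namespace Jamming

open Filter Topology

/-! ### Measurable selection of maximizers -/

section Selection

variable {Ω : Type*} [MeasurableSpace Ω]

/-- Measurable selection of a maximizer over a compact set of reals: take the least one. -/
theorem exists_measurable_argmax_real {C : Set ℝ} (hC : IsCompact C) (hne : C.Nonempty)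
    (F : Ω → C → ℝ) (hm : ∀ c, Measurable fun ω => F ω c) (hc : ∀ ω, Continuous (F ω)) :
    ∃ s : Ω → C, Measurable s ∧ ∀ ω c, F ω c ≤ F ω (s ω) := by
  have : CompactSpace C := isCompact_iff_compactSpace.mp hC
  have : Nonempty C := hne.to_subtype
  have hmax : ∀ ω, ∃ c, ∀ u, F ω u ≤ F ω c := fun ω => by
    obtain ⟨c, -, h⟩ := isCompact_univ.exists_isMaxOn univ_nonempty (hc ω).continuousOn
    exact ⟨c, fun u => h (mem_univ u)⟩
  have hleast : ∀ ω, ∃ c, (∀ u, F ω u ≤ F ω c) ∧ ∀ c', (∀ u, F ω u ≤ F ω c') → c ≤ c' := fun ω => by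
    have hcl : IsCompact {c | ∀ u, F ω u ≤ F ω c} := by
      apply IsClosed.isCompact
      simp only [ofPred_forall]
      exact isClosed_iInter fun u => isClosed_le continuous_const (hc ω)
    obtain ⟨c, h1, h2⟩ := hcl.exists_isMinOn (hmax ω) continuous_subtype_val.continuousOn
    exact ⟨c, h1, fun c' h => h2 h⟩
  choose s hs hs' using hleast
  refine ⟨s, ?_, fun ω c => hs ω c⟩
  suffices h : Measurable fun ω => (s ω : ℝ) from h.subtype_mk
  apply measurable_of_Iic
  intro a
  let A : Set C := {c | (c : ℝ) ≤ a}
  have hAcl : IsClosed A := isClosed_le continuous_subtype_val continuous_const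
  rcases A.eq_empty_or_nonempty with hA | hA
  · have : (fun ω => (s ω : ℝ)) ⁻¹' Iic a = ∅ := by
      ext ω
      simp only [mem_preimage, mem_Iic, mem_empty_iff_false, iff_false]
      exact fun h => (hA ▸ (show s ω ∈ A from h) : s ω ∈ (∅ : Set C))
    rw [this]
    exact MeasurableSet.empty
  have : Nonempty A := hA.to_subtype
  -- The least maximizer is at most a exactly when the maximum over C is attained on A. Comparing
  -- the two suprema along dense sequences makes this a countable condition; the slack 1/(k+1) is
  -- needed because a dense sequence may miss the maximizer.
  have hkey : (fun ω => (s ω : ℝ)) ⁻¹' Iic a = {ω | ∀ (n k : ℕ), ∃ m,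
      F ω (TopologicalSpace.denseSeq C n) <
        F ω (TopologicalSpace.denseSeq A m : C) + 1 / ((k : ℝ) + 1)} := by
    ext ω
    simp only [mem_preimage, mem_Iic, mem_ofPred_eq]
    constructor
    · intro h n k
      have hO : IsOpen {c : A | F ω (s ω) - 1 / ((k : ℝ) + 1) < F ω c} :=
        isOpen_lt continuous_const ((hc ω).comp continuous_subtype_val)
      have hpos : 0 < 1 / ((k : ℝ) + 1) := by positivity
      obtain ⟨m, hm'⟩ := (TopologicalSpace.denseRange_denseSeq A).exists_mem_open hO
        ⟨⟨s ω, h⟩, show F ω (s ω) - 1 / ((k : ℝ) + 1) < F ω (s ω) by linarith⟩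
      have hm'' : F ω (s ω) - 1 / ((k : ℝ) + 1) < F ω (TopologicalSpace.denseSeq A m : C) := hm'
      exact ⟨m, by have := hs ω (TopologicalSpace.denseSeq C n); linarith⟩
    · intro h
      obtain ⟨c, hca, hcm⟩ := hAcl.isCompact.exists_isMaxOn hA (hc ω).continuousOn
      refine le_trans (Subtype.coe_le_coe.2 (hs' ω c ?_)) hca
      have h1 : ∀ n, F ω (TopologicalSpace.denseSeq C n) ≤ F ω c := by
        intro n
        apply le_of_forall_pos_lt_add
        intro ε hε
        obtain ⟨k, hk⟩ := exists_nat_one_div_lt hε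
        obtain ⟨m, hm⟩ := h n k
        have := hcm (TopologicalSpace.denseSeq A m).2
        simp only [mem_ofPred_eq] at this
        linarith
      intro u
      have hcl2 : IsClosed {u | F ω u ≤ F ω c} := isClosed_le (hc ω) continuous_const
      have := (TopologicalSpace.denseRange_denseSeq C).closure_range ▸
        hcl2.closure_subset_iff.mpr (range_subset_iff.mpr h1)
      exact this (mem_univ u)
  rw [hkey]
  simp only [ofPred_forall, ofPred_exists]
  exact MeasurableSet.iInter fun n => MeasurableSet.iInter fun k => MeasurableSet.iUnion fun m =>
    measurableSet_lt (hm _) ((hm _).add_const _)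

/-- Measurable selection of a maximizer over a compact set, for a function that is measurable in
the parameter and continuous in the variable. -/
theorem exists_measurable_argmax {E : Type*} [MetricSpace E] [MeasurableSpace E] [BorelSpace E]
    {D : Set E} (hD : IsCompact D) (hne : D.Nonempty)
    (F : Ω → E → ℝ) (hm : ∀ c, Measurable fun ω => F ω c) (hc : ∀ ω, Continuous (F ω)) :
    ∃ s : Ω → E, Measurable s ∧ (∀ ω, s ω ∈ D) ∧ ∀ ω, ∀ c ∈ D, F ω c ≤ F ω (s ω) := by
  have : CompactSpace D := isCompact_iff_compactSpace.mp hD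
  have : Nonempty D := hne.to_subtype
  -- A nonempty compact metric space is a continuous image of the Cantor set, a compact set of
  -- reals, so the choice of a least maximizer can be made there and pushed forward.
  obtain ⟨φ, hφ, hsurj⟩ := exists_nat_bool_continuous_surjective_of_compact D
  let ψ : cantorSet → D := fun c => φ (cantorSetHomeomorphNatToBool c)
  have hψ : Continuous ψ := hφ.comp cantorSetHomeomorphNatToBool.continuous
  obtain ⟨s, hs, hmax⟩ := exists_measurable_argmax_real isCompact_cantorSet
    ⟨0, zero_mem_cantorSet⟩ (fun ω c => F ω (ψ c)) (fun c => hm _)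
    (fun ω => (hc ω).comp (continuous_subtype_val.comp hψ))
  refine ⟨fun ω => ψ (s ω), (continuous_subtype_val.comp hψ).measurable.comp hs,
    fun ω => (ψ (s ω)).2, fun ω c hcD => ?_⟩
  obtain ⟨b, hb⟩ := hsurj ⟨c, hcD⟩
  have := hmax ω (cantorSetHomeomorphNatToBool.symm b)
  simpa [ψ, hb] using this

end Selection

/-! ### Right derivatives of concave curves -/

section RightSlope

variable {f : ℝ → ℝ} {B : ℝ}

theorem concave_secant_anti {s : Set ℝ} (hf : ConcaveOn ℝ s f) {a x y : ℝ} (ha : a ∈ s)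
    (hx : x ∈ s) (hy : y ∈ s) (hxa : x ≠ a) (hya : y ≠ a) (hxy : x ≤ y) :
    (f y - f a) / (y - a) ≤ (f x - f a) / (x - a) := by
  have := hf.neg.secant_mono ha hx hy hxa hya hxy
  simp only [Pi.neg_apply, neg_sub_neg] at this
  rw [← neg_sub (f x), ← neg_sub (f y), neg_div, neg_div] at this
  linarith

/-- The right derivative of a concave curve on `[0, ∞)` with linear growth at the origin. -/
theorem hasDerivWithinAt_Ioi_of_concaveOn (hf : ConcaveOn ℝ (Ici 0) f)
    (hB : ∀ d, 0 ≤ d → f d ≤ f 0 + d * B) {j : ℝ} (hj : 0 ≤ j) :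
    HasDerivWithinAt f (derivWithin f (Ioi j) j) (Ioi j) j := by
  have hanti : AntitoneOn (fun t => (f t - f j) / (t - j)) (Ioi j) := by
    intro a ha b hb hab
    rcases hab.eq_or_lt with rfl | hab
    · exact le_rfl
    have ha' : j < a := ha
    exact concave_secant_anti hf hj (hj.trans ha'.le) (hj.trans (ha'.le.trans hab.le))
      ha'.ne' (ha'.trans hab).ne' hab.le
  have hbdd : BddAbove ((fun t => (f t - f j) / (t - j)) '' Ioi j) := by
    -- For j > 0 the secant from 0 bounds the right secants. At j = 0 there is nothing to the left,
    -- and the growth bound `hB` takes its place.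
    rcases hj.eq_or_lt with rfl | hj0
    · refine ⟨B, ?_⟩
      rintro _ ⟨t, ht, rfl⟩
      have ht : 0 < t := ht
      simp only [sub_zero]
      rw [div_le_iff₀ ht]
      have := hB t ht.le
      linarith
    · refine ⟨(f 0 - f j) / (0 - j), ?_⟩
      rintro _ ⟨t, ht, rfl⟩
      have ht : j < t := ht
      exact concave_secant_anti hf (x := 0) (y := t) hj (self_mem_Ici) (hj.trans ht.le) hj0.ne ht.ne'
        (hj.trans ht.le)
  have hmono : MonotoneOn (fun t => -((f t - f j) / (t - j))) (Ioi j) := fun a ha b hb hab =>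
    neg_le_neg (hanti ha hb hab)
  have hlim := hmono.tendsto_nhdsGT (x := j) (by
    obtain ⟨b, hb⟩ := hbdd
    refine ⟨-b, ?_⟩
    rintro _ ⟨t, ht, rfl⟩
    exact neg_le_neg (hb ⟨t, ht, rfl⟩))
  have hder : HasDerivWithinAt f
      (-sInf ((fun t => -((f t - f j) / (t - j))) '' Ioi j)) (Ioi j) j := by
    rw [hasDerivWithinAt_iff_tendsto_slope' (by simp)]
    refine hlim.neg.congr fun t => ?_
    simp [slope_def_field]
  have := hder.derivWithin (uniqueDiffWithinAt_Ioi j)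
  rwa [this]

theorem secant_tendsto (hf : ConcaveOn ℝ (Ici 0) f)
    (hB : ∀ d, 0 ≤ d → f d ≤ f 0 + d * B) {j : ℝ} (hj : 0 ≤ j) :
    Tendsto (fun t => (f t - f j) / (t - j)) (𝓝[>] j) (𝓝 (derivWithin f (Ioi j) j)) := by
  have := hasDerivWithinAt_Ioi_of_concaveOn hf hB hj
  rw [hasDerivWithinAt_iff_tendsto_slope' (by simp)] at this
  refine this.congr fun t => ?_
  simp [slope_def_field]

/-- To the right of `j` the curve lies below the tangent at `j`. -/
theorem le_right_tangent (hf : ConcaveOn ℝ (Ici 0) f)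
    (hB : ∀ d, 0 ≤ d → f d ≤ f 0 + d * B) {j t : ℝ} (hj : 0 ≤ j) (ht : j ≤ t) :
    f t ≤ f j + derivWithin f (Ioi j) j * (t - j) := by
  rcases ht.eq_or_lt with rfl | ht
  · simp
  have h : (f t - f j) / (t - j) ≤ derivWithin f (Ioi j) j := by
    refine ge_of_tendsto (secant_tendsto hf hB hj) ?_
    filter_upwards [Ioo_mem_nhdsGT ht] with u hu
    exact concave_secant_anti hf hj (hj.trans hu.1.le) (hj.trans ht.le) hu.1.ne' ht.ne' hu.2.le
  rw [div_le_iff₀ (sub_pos.2 ht)] at h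
  linarith

/-- To the left of `j` the curve lies below the right tangent at `j`. -/
theorem le_right_tangent_left (hf : ConcaveOn ℝ (Ici 0) f)
    (hB : ∀ d, 0 ≤ d → f d ≤ f 0 + d * B) {u j : ℝ} (hu : 0 ≤ u) (huj : u ≤ j) :
    f u ≤ f j + derivWithin f (Ioi j) j * (u - j) := by
  rcases huj.eq_or_lt with rfl | huj
  · simp
  have hj : 0 ≤ j := hu.trans huj.le
  have h : derivWithin f (Ioi j) j ≤ (f u - f j) / (u - j) := by
    refine le_of_tendsto (secant_tendsto hf hB hj) ?_
    filter_upwards [self_mem_nhdsWithin] with t ht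
    have ht : j < t := ht
    exact concave_secant_anti hf hj hu (hj.trans ht.le) huj.ne ht.ne' (huj.le.trans ht.le)
  rw [le_div_iff_of_neg (sub_neg.2 huj)] at h
  linarith

/-- A bound near j suffices since the slope is a limit. Only this is available below a cap, where
the price inequality controls the curve just until it meets K. -/
theorem right_slope_le (hf : ConcaveOn ℝ (Ici 0) f)
    (hB : ∀ d, 0 ≤ d → f d ≤ f 0 + d * B) {j l : ℝ} (hj : 0 ≤ j)
    (h : ∀ᶠ t in 𝓝[>] j, f t ≤ f j + l * (t - j)) :
    derivWithin f (Ioi j) j ≤ l := by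
  refine le_of_tendsto (secant_tendsto hf hB hj) ?_
  filter_upwards [h, self_mem_nhdsWithin] with t ht htj
  rw [div_le_iff₀ (sub_pos.2 htj)]
  linarith

theorem le_right_slope (hf : ConcaveOn ℝ (Ici 0) f)
    (hB : ∀ d, 0 ≤ d → f d ≤ f 0 + d * B) {j t l : ℝ} (hj : 0 ≤ j) (ht : j < t)
    (h : f j + l * (t - j) ≤ f t) : l ≤ derivWithin f (Ioi j) j := by
  have h1 := le_right_tangent hf hB hj ht.le
  have h2 : 0 < t - j := sub_pos.2 ht
  by_contra! h3
  nlinarith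

/-- If all right slopes on `[u, j)` are at least `l`, so is the secant slope. -/
theorem secant_ge_of_right_slope_ge (hf : ConcaveOn ℝ (Ici 0) f)
    (hB : ∀ d, 0 ≤ d → f d ≤ f 0 + d * B) (hc : ContinuousOn f (Ici 0)) {u j l : ℝ} (hu : 0 ≤ u)
    (huj : u < j) (h : ∀ t, 0 ≤ t → t < j → l ≤ derivWithin f (Ioi t) t) :
    f u + l * (j - u) ≤ f j := by
  have hj : 0 < j := hu.trans_lt huj
  have hcj : Tendsto f (𝓝[<] j) (𝓝 (f j)) :=
    ((hc.continuousAt (Ici_mem_nhds hj)).tendsto).mono_left nhdsWithin_le_nhds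
  have hcl : Tendsto (fun t => f u + l * (t - u)) (𝓝[<] j) (𝓝 (f u + l * (j - u))) :=
    Continuous.tendsto' (by fun_prop) _ _ rfl |>.mono_left nhdsWithin_le_nhds
  -- The slope hypothesis stops short of j: the estimate is obtained for t < j from the tangent at
  -- t, and continuity carries it to j.
  refine le_of_tendsto_of_tendsto hcl hcj ?_
  filter_upwards [Ioo_mem_nhdsLT huj] with t ht
  have h1 := le_right_tangent_left hf hB hu ht.1.le
  have h2 := h t (hu.trans ht.1.le) ht.2
  have h3 : 0 < t - u := sub_pos.2 ht.1
  nlinarith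

end RightSlope

/-- A measurable family of concave curves on `[0, ∞)` whose growth is controlled from both sides
by a weight `S`. -/
structure IsCurveFamily {Ω : Type*} [MeasurableSpace Ω] (f : Ω → ℝ → ℝ) (S : Ω → ℝ)
    (a A b : ℝ) : Prop where
  a_pos : 0 < a
  A_pos : 0 < A
  b_pos : 0 < b
  weight_pos : ∀ ω, 0 < S ω
  weight_measurable : Measurable S
  measurable : ∀ j, 0 ≤ j → Measurable fun ω => f ω j
  concave : ∀ ω, ConcaveOn ℝ (Ici 0) (f ω)
  continuous : ∀ ω, ContinuousOn (f ω) (Ici 0)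
  nonneg : ∀ ω j, 0 ≤ j → 0 ≤ f ω j
  lower : ∀ ω j d, 0 ≤ j → 0 ≤ d → f ω j + d * (a / S ω) ≤ f ω (j + d)
  upper : ∀ ω j, 0 ≤ j → f ω j ≤ (A + b * j) / S ω
  linear : ∀ ω, ∃ B, ∀ d, 0 ≤ d → f ω d ≤ f ω 0 + d * B

/-! ### The characteristic curve of a single frame -/

section Channel

variable {M : ℕ} {N R : ℝ}

/-- Frame power used by the transmitter when the fraction `w m` of the total rate is carried by
block `m`. -/
noncomputable def ratePower (N R : ℝ) (h J w : Fin M → ℝ) : ℝ :=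
  frameMean fun m => (N + J m) / h m * (Real.exp (R * M * w m) - 1)

theorem frameMean_mono {x y : Fin M → ℝ} (h : ∀ m, x m ≤ y m) : frameMean x ≤ frameMean y := by
  unfold frameMean
  gcongr with m
  exact h m

theorem frameMean_nonneg {x : Fin M → ℝ} (h : ∀ m, 0 ≤ x m) : 0 ≤ frameMean x := by
  unfold frameMean
  exact mul_nonneg (by positivity) (Finset.sum_nonneg fun m _ => h m)

theorem frameMean_add (x y : Fin M → ℝ) :
    frameMean (fun m => x m + y m) = frameMean x + frameMean y := by
  simp [frameMean, Finset.sum_add_distrib, mul_add]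

theorem frameMean_const_mul (c : ℝ) (x : Fin M → ℝ) :
    frameMean (fun m => c * x m) = c * frameMean x := by
  simp only [frameMean, ← Finset.mul_sum]
  ring

theorem frameMean_const (hM : 0 < M) (c : ℝ) : frameMean (fun _ : Fin M => c) = c := by
  have : (M : ℝ) ≠ 0 := by positivity
  simp [frameMean, this]

theorem continuous_frameMean : Continuous (frameMean : (Fin M → ℝ) → ℝ) := by
  unfold frameMean
  fun_prop

theorem le_mul_frameMean (hM : 0 < M) {x : Fin M → ℝ} (hx : ∀ m, 0 ≤ x m) (m : Fin M) :
    x m ≤ M * frameMean x := by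
  have : (M : ℝ) ≠ 0 := by positivity
  rw [frameMean, ← mul_assoc, mul_one_div_cancel this, one_mul]
  exact Finset.single_le_sum (fun i _ => hx i) (Finset.mem_univ m)

theorem frameMean_simplex (hM : 0 < M) (j : ℝ) {v : Fin M → ℝ} (hv : v ∈ stdSimplex ℝ (Fin M)) :
    frameMean (fun m => j * M * v m) = j := by
  have : (M : ℝ) ≠ 0 := by positivity
  rw [frameMean_const_mul, frameMean, hv.2]
  field_simp

theorem simplex_nonempty (hM : 0 < M) : (stdSimplex ℝ (Fin M)).Nonempty :=
  ⟨Pi.single ⟨0, hM⟩ 1, single_mem_stdSimplex ℝ _⟩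

theorem continuous_ratePower (h : Fin M → ℝ) :
    Continuous fun q : (Fin M → ℝ) × (Fin M → ℝ) => ratePower N R h q.1 q.2 := by
  unfold ratePower frameMean
  fun_prop

theorem requiredPower_le (h J P : Fin M → ℝ) (hP : ∀ m, 0 ≤ P m) (hI : R ≤ mutualInfo N h P J) :
    requiredPower N R h J ≤ frameMean P := by
  refine csInf_le ⟨0, ?_⟩ ⟨P, hP, hI, rfl⟩
  rintro _ ⟨P, hP, -, rfl⟩
  exact frameMean_nonneg hP

/-- Block powers of the transmitter for given rate fractions. -/
noncomputable def blockPower (N R : ℝ) (h J w : Fin M → ℝ) (m : Fin M) : ℝ :=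
  (N + J m) / h m * (Real.exp (R * M * w m) - 1)

variable (hM : 0 < M) (hN : 0 < N) (hR : 0 < R)

include hN hR in
theorem blockPower_nonneg {h J w : Fin M → ℝ} (hh : ∀ m, 0 < h m) (hJ : ∀ m, 0 ≤ J m)
    (hw : w ∈ stdSimplex ℝ (Fin M)) (m : Fin M) : 0 ≤ blockPower N R h J w m := by
  have h1 := hw.1 m
  have h2 := hJ m
  have h3 := hh m
  refine mul_nonneg (by positivity) (sub_nonneg.2 (Real.one_le_exp (by positivity)))

include hM hN in
theorem mutualInfo_blockPower {h J w : Fin M → ℝ} (hh : ∀ m, 0 < h m) (hJ : ∀ m, 0 ≤ J m)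
    (hw : w ∈ stdSimplex ℝ (Fin M)) : mutualInfo N h (blockPower N R h J w) J = R := by
  have hM' : (M : ℝ) ≠ 0 := by positivity
  have : ∀ m, Real.log (1 + h m * blockPower N R h J w m / (N + J m)) = R * M * w m := by
    intro m
    have h2 := hJ m
    have h3 := hh m
    have h4 : N + J m ≠ 0 := by positivity
    rw [← Real.log_exp (R * M * w m)]
    congr 1
    unfold blockPower
    field_simp
    ring
  unfold mutualInfo
  simp only [this]
  exact frameMean_simplex hM R hw

include hM hN hR in
-- The fractions are the block rates of `P` divided by their sum. As that sum is at least R·M,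
-- rescaling to total rate exactly R·M lowers every block rate, hence every block power. The search
-- for the required power thus reduces to a compact simplex.
theorem exists_ratePower_le {h J P : Fin M → ℝ} (hh : ∀ m, 0 < h m) (hJ : ∀ m, 0 ≤ J m)
    (hP : ∀ m, 0 ≤ P m) (hI : R ≤ mutualInfo N h P J) :
    ∃ w ∈ stdSimplex ℝ (Fin M), ratePower N R h J w ≤ frameMean P := by
  have hM' : (0 : ℝ) < M := by positivity
  set x : Fin M → ℝ := fun m => Real.log (1 + h m * P m / (N + J m)) with hx
  have hq : ∀ m, 0 ≤ h m * P m / (N + J m) := fun m => by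
    have h2 := hJ m
    have h3 := hh m
    have h4 := hP m
    positivity
  have hx0 : ∀ m, 0 ≤ x m := fun m => Real.log_nonneg (by linarith [hq m])
  have hX : R * M ≤ ∑ m, x m := by
    have h1 : R ≤ 1 / (M : ℝ) * ∑ m, x m := hI
    rw [one_div, inv_mul_eq_div, le_div_iff₀ hM'] at h1
    exact h1
  have hX0 : 0 < ∑ m, x m := lt_of_lt_of_le (by positivity) hX
  refine ⟨fun m => x m / ∑ m, x m, ⟨fun m => div_nonneg (hx0 m) hX0.le, ?_⟩, ?_⟩
  · rw [← Finset.sum_div, div_self hX0.ne']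
  · refine frameMean_mono fun m => ?_
    have h2 := hJ m
    have h3 := hh m
    have h5 : R * M * (x m / ∑ m, x m) ≤ x m := by
      rw [mul_div_assoc', div_le_iff₀ hX0, mul_comm]
      exact mul_le_mul_of_nonneg_left hX (hx0 m)
    have h6 : Real.exp (R * M * (x m / ∑ m, x m)) ≤ 1 + h m * P m / (N + J m) := by
      refine (Real.exp_le_exp.2 h5).trans ?_
      rw [hx, Real.exp_log (by linarith [hq m])]
    calc (N + J m) / h m * (Real.exp (R * M * (x m / ∑ m, x m)) - 1)
        ≤ (N + J m) / h m * (h m * P m / (N + J m)) := by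
          refine mul_le_mul_of_nonneg_left (by linarith) (by positivity)
      _ = P m := by
          have : N + J m ≠ 0 := by positivity
          field_simp

include hM hN hR in
theorem requiredPower_le_ratePower {h J w : Fin M → ℝ} (hh : ∀ m, 0 < h m) (hJ : ∀ m, 0 ≤ J m)
    (hw : w ∈ stdSimplex ℝ (Fin M)) : requiredPower N R h J ≤ ratePower N R h J w :=
  requiredPower_le h J _ (blockPower_nonneg hN hR hh hJ hw)
    (mutualInfo_blockPower hM hN hh hJ hw).ge

include hM hN hR in
theorem requiredPower_eq_of_isMin {h J w : Fin M → ℝ} (hh : ∀ m, 0 < h m) (hJ : ∀ m, 0 ≤ J m)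
    (hw : w ∈ stdSimplex ℝ (Fin M))
    (hmin : ∀ w' ∈ stdSimplex ℝ (Fin M), ratePower N R h J w ≤ ratePower N R h J w') :
    requiredPower N R h J = ratePower N R h J w := by
  refine le_antisymm (requiredPower_le_ratePower hM hN hR hh hJ hw) (le_csInf ?_ ?_)
  · exact ⟨_, _, blockPower_nonneg hN hR hh hJ hw, (mutualInfo_blockPower hM hN hh hJ hw).ge, rfl⟩
  · rintro _ ⟨P, hP, hI, rfl⟩
    obtain ⟨w', hw', h'⟩ := exists_ratePower_le hM hN hR hh hJ hP hI
    exact (hmin w' hw').trans h'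

include hM hN hR in
theorem exists_requiredPower_eq {h J : Fin M → ℝ} (hh : ∀ m, 0 < h m) (hJ : ∀ m, 0 ≤ J m) :
    ∃ w ∈ stdSimplex ℝ (Fin M), requiredPower N R h J = ratePower N R h J w := by
  obtain ⟨w, hw, hmin⟩ := (isCompact_stdSimplex ℝ (Fin M)).exists_isMinOn (simplex_nonempty hM)
    ((continuous_ratePower (N := N) (R := R) h).comp (Continuous.prodMk_right J)).continuousOn
  exact ⟨w, hw, requiredPower_eq_of_isMin hM hN hR hh hJ hw fun w' hw' => hmin hw'⟩

/-- The minimum of `ratePower` over the rate fractions. -/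
noncomputable def minRatePower (N R : ℝ) (h J : Fin M → ℝ) : ℝ :=
  sInf (ratePower N R h J '' stdSimplex ℝ (Fin M))

theorem continuous_minRatePower (h : Fin M → ℝ) :
    Continuous (minRatePower (M := M) N R h) :=
  (isCompact_stdSimplex ℝ (Fin M)).continuous_sInf (continuous_ratePower h)

theorem minRatePower_eq_of_isMin {h J w : Fin M → ℝ} (hw : w ∈ stdSimplex ℝ (Fin M))
    (hmin : ∀ w' ∈ stdSimplex ℝ (Fin M), ratePower N R h J w ≤ ratePower N R h J w') :
    minRatePower N R h J = ratePower N R h J w := by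
  refine IsLeast.csInf_eq ⟨⟨w, hw, rfl⟩, ?_⟩
  rintro _ ⟨w', hw', rfl⟩
  exact hmin w' hw'

include hM hN hR in
-- `minRatePower` is a minimum over a fixed compact set and continuous for all real `J`; this
-- identity transfers continuity and measurability to the required power.
theorem requiredPower_eq_minRatePower {h J : Fin M → ℝ} (hh : ∀ m, 0 < h m) (hJ : ∀ m, 0 ≤ J m) :
    requiredPower N R h J = minRatePower N R h J := by
  obtain ⟨w, hw, hmin⟩ := (isCompact_stdSimplex ℝ (Fin M)).exists_isMinOn (simplex_nonempty hM)
    ((continuous_ratePower (N := N) (R := R) h).comp (Continuous.prodMk_right J)).continuousOn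
  rw [requiredPower_eq_of_isMin hM hN hR hh hJ hw fun w' hw' => hmin hw',
    minRatePower_eq_of_isMin hw fun w' hw' => hmin hw']

theorem ratePower_mono {h J J' w : Fin M → ℝ} (hR : 0 < R) (hh : ∀ m, 0 < h m)
    (hJ : ∀ m, J m ≤ J' m)
    (hw : w ∈ stdSimplex ℝ (Fin M)) : ratePower N R h J w ≤ ratePower N R h J' w := by
  refine frameMean_mono fun m => ?_
  have h1 := hw.1 m
  have h3 := hh m
  refine mul_le_mul_of_nonneg_right ?_ (sub_nonneg.2 (Real.one_le_exp (by positivity)))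
  gcongr
  exact hJ m

include hM hN hR in
theorem requiredPower_mono {h J J' : Fin M → ℝ} (hh : ∀ m, 0 < h m) (hJ0 : ∀ m, 0 ≤ J m)
    (hJ : ∀ m, J m ≤ J' m) : requiredPower N R h J ≤ requiredPower N R h J' := by
  obtain ⟨w, hw, h1⟩ := exists_requiredPower_eq hM hN hR hh fun m => (hJ0 m).trans (hJ m)
  rw [h1]
  exact (requiredPower_le_ratePower hM hN hR hh hJ0 hw).trans (ratePower_mono hR hh hJ hw)

include hM in
-- Unused jamming power is spread evenly over the blocks. By monotonicity the constraint may then be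
-- taken with equality, and the jammer's choices are parametrized by a simplex that does not depend
-- on j.
theorem exists_simplex_dominating {J : Fin M → ℝ} {j : ℝ} (hJ0 : ∀ m, 0 ≤ J m)
    (hj : frameMean J ≤ j) : ∃ v ∈ stdSimplex ℝ (Fin M), ∀ m, J m ≤ j * M * v m := by
  have hM' : (0 : ℝ) < M := by positivity
  have hj0 : 0 ≤ j := (frameMean_nonneg hJ0).trans hj
  rcases hj0.eq_or_lt with rfl | hj0
  · obtain ⟨v, hv⟩ := simplex_nonempty hM
    refine ⟨v, hv, fun m => ?_⟩
    have h1 := le_mul_frameMean hM hJ0 m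
    have h2 : frameMean J = 0 := le_antisymm hj (frameMean_nonneg hJ0)
    simpa [h2] using h1
  · have hs : frameMean J / j ≤ 1 := (div_le_one hj0).2 hj
    refine ⟨fun m => J m / (j * M) + (1 - frameMean J / j) / M, ⟨fun m => ?_, ?_⟩, fun m => ?_⟩
    · exact add_nonneg (div_nonneg (hJ0 m) (by positivity)) (div_nonneg (by linarith) hM'.le)
    · rw [Finset.sum_add_distrib, ← Finset.sum_div]
      simp only [frameMean, Finset.sum_const, Finset.card_univ, Fintype.card_fin, nsmul_eq_mul]
      field_simp
      ring
    · have : 0 ≤ (1 - frameMean J / j) / M := div_nonneg (by linarith) hM'.le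
      rw [mul_add, mul_div_cancel₀ _ (by positivity)]
      have := mul_nonneg (mul_nonneg hj0.le hM'.le) this
      linarith

include hM hN hR in
theorem charCurve_eq_of_isMax {h v : Fin M → ℝ} (hh : ∀ m, 0 < h m) {j : ℝ} (hj : 0 ≤ j)
    (hv : v ∈ stdSimplex ℝ (Fin M))
    (hmax : ∀ v' ∈ stdSimplex ℝ (Fin M), minRatePower N R h (fun m => j * M * v' m) ≤
      minRatePower N R h (fun m => j * M * v m)) :
    charCurve N R h j = minRatePower N R h (fun m => j * M * v m) := by
  have hpos : ∀ v ∈ stdSimplex ℝ (Fin M), ∀ m, 0 ≤ j * M * v m := fun v hv m => by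
    have := hv.1 m
    positivity
  refine IsGreatest.csSup_eq ⟨⟨_, hpos v hv, (frameMean_simplex hM j hv).le,
    (requiredPower_eq_minRatePower hM hN hR hh (hpos v hv)).symm⟩, ?_⟩
  rintro _ ⟨J, hJ0, hJ, rfl⟩
  obtain ⟨v', hv', hle⟩ := exists_simplex_dominating hM hJ0 hJ
  refine (requiredPower_mono hM hN hR hh hJ0 hle).trans ?_
  rw [requiredPower_eq_minRatePower hM hN hR hh (hpos v' hv')]
  exact hmax v' hv'

theorem continuous_minRatePower_simplex (h : Fin M → ℝ) :
    Continuous fun q : ℝ × (Fin M → ℝ) => minRatePower N R h (fun m => q.1 * M * q.2 m) :=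
  (continuous_minRatePower h).comp (by fun_prop)

include hM hN hR in
theorem exists_charCurve_eq {h : Fin M → ℝ} (hh : ∀ m, 0 < h m) {j : ℝ} (hj : 0 ≤ j) :
    ∃ v ∈ stdSimplex ℝ (Fin M), (∀ v' ∈ stdSimplex ℝ (Fin M),
      minRatePower N R h (fun m => j * M * v' m) ≤ minRatePower N R h (fun m => j * M * v m)) ∧
      charCurve N R h j = minRatePower N R h (fun m => j * M * v m) := by
  obtain ⟨v, hv, hmax⟩ := (isCompact_stdSimplex ℝ (Fin M)).exists_isMaxOn (simplex_nonempty hM)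
    ((continuous_minRatePower_simplex (N := N) (R := R) h).comp
      (Continuous.prodMk_right j)).continuousOn
  exact ⟨v, hv, fun v' hv' => hmax hv',
    charCurve_eq_of_isMax hM hN hR hh hj hv fun v' hv' => hmax hv'⟩

include hM hN hR in
theorem exists_charCurve_eq_requiredPower {h : Fin M → ℝ} (hh : ∀ m, 0 < h m) {j : ℝ}
    (hj : 0 ≤ j) : ∃ J : Fin M → ℝ, (∀ m, 0 ≤ J m) ∧ frameMean J = j ∧
      charCurve N R h j = requiredPower N R h J := by
  obtain ⟨v, hv, -, h1⟩ := exists_charCurve_eq hM hN hR hh hj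
  have hpos : ∀ m, 0 ≤ j * M * v m := fun m => by
    have := hv.1 m
    positivity
  exact ⟨_, hpos, frameMean_simplex hM j hv,
    by rw [h1, requiredPower_eq_minRatePower hM hN hR hh hpos]⟩

include hM hN hR in
theorem requiredPower_le_charCurve {h J : Fin M → ℝ} (hh : ∀ m, 0 < h m) {j : ℝ}
    (hJ0 : ∀ m, 0 ≤ J m) (hJ : frameMean J ≤ j) :
    requiredPower N R h J ≤ charCurve N R h j := by
  have hj : 0 ≤ j := (frameMean_nonneg hJ0).trans hJ
  obtain ⟨v, hv, hmax, h1⟩ := exists_charCurve_eq hM hN hR hh hj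
  obtain ⟨v', hv', hle⟩ := exists_simplex_dominating hM hJ0 hJ
  refine (requiredPower_mono hM hN hR hh hJ0 hle).trans ?_
  rw [requiredPower_eq_minRatePower hM hN hR hh, h1]
  · exact hmax v' hv'
  · intro m
    have := hv'.1 m
    positivity

include hM hN hR in
theorem charCurve_continuousOn {h : Fin M → ℝ} (hh : ∀ m, 0 < h m) :
    ContinuousOn (charCurve N R h) (Ici 0) := by
  have h1 : Continuous fun j : ℝ =>
      sSup ((fun v : Fin M → ℝ => minRatePower N R h (fun m => j * M * v m)) ''
        stdSimplex ℝ (Fin M)) :=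
    (isCompact_stdSimplex ℝ (Fin M)).continuous_sSup (continuous_minRatePower_simplex h)
  refine h1.continuousOn.congr fun j hj => ?_
  obtain ⟨v, hv, hmax, h2⟩ := exists_charCurve_eq hM hN hR hh hj
  rw [h2]
  refine (IsGreatest.csSup_eq ⟨mem_image_of_mem
    (fun v : Fin M → ℝ => minRatePower N R h (fun m => j * M * v m)) hv, ?_⟩).symm
  rintro _ ⟨v', hv', rfl⟩
  exact hmax v' hv'

include hM hN hR in
-- For fixed rate fractions the transmitter's power is affine in `J`, so its minimum over fractions
-- is concave in `J`. Maximizing a jointly concave problem over the distribution of j leaves a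
-- concave function of j.
theorem charCurve_concaveOn {h : Fin M → ℝ} (hh : ∀ m, 0 < h m) :
    ConcaveOn ℝ (Ici 0) (charCurve N R h) := by
  refine ⟨convex_Ici 0, fun j hj k hk s t hs ht hst => ?_⟩
  obtain ⟨J, hJ0, hJ, h1⟩ := exists_charCurve_eq_requiredPower (N := N) hM hN hR hh hj
  obtain ⟨L, hL0, hL, h2⟩ := exists_charCurve_eq_requiredPower (N := N) hM hN hR hh hk
  have hpos : ∀ m, 0 ≤ s * J m + t * L m := fun m => by
    have := hJ0 m
    have := hL0 m
    positivity
  obtain ⟨w, hw, h3⟩ := exists_requiredPower_eq (N := N) hM hN hR hh hpos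
  have h4 : requiredPower N R h (fun m => s * J m + t * L m) ≤
      charCurve N R h (s • j + t • k) := by
    refine requiredPower_le_charCurve hM hN hR hh hpos ?_
    rw [frameMean_add, frameMean_const_mul, frameMean_const_mul, hJ, hL]
    simp
  refine le_trans ?_ h4
  rw [h1, h2, h3]
  have h5 := requiredPower_le_ratePower hM hN hR hh hJ0 hw
  have h6 := requiredPower_le_ratePower hM hN hR hh hL0 hw
  have h7 : ratePower N R h (fun m => s * J m + t * L m) w =
      s * ratePower N R h J w + t * ratePower N R h L w := by
    unfold ratePower
    rw [← frameMean_const_mul, ← frameMean_const_mul, ← frameMean_add]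
    congr 1
    ext m
    obtain rfl : t = 1 - s := by linarith
    ring
  rw [h7]
  simp only [smul_eq_mul]
  gcongr

theorem requiredPower_nonneg {h J : Fin M → ℝ} : 0 ≤ requiredPower N R h J := by
  refine Real.sInf_nonneg ?_
  rintro _ ⟨P, hP, -, rfl⟩
  exact frameMean_nonneg hP

include hM hN hR in
-- Adding d to every block raises the power by the mean of d(exp(RM·w_m) − 1)/h_m; then exp x − 1 ≥
-- x, h_m ≤ ∑ h, and the fractions sum to 1.
theorem charCurve_lower {h : Fin M → ℝ} (hh : ∀ m, 0 < h m) {j d : ℝ} (hj : 0 ≤ j) (hd : 0 ≤ d) :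
    charCurve N R h j + d * (R / ∑ m, h m) ≤ charCurve N R h (j + d) := by
  obtain ⟨J, hJ0, hJ, h1⟩ := exists_charCurve_eq_requiredPower (N := N) hM hN hR hh hj
  have hpos : ∀ m, 0 ≤ J m + d := fun m => add_nonneg (hJ0 m) hd
  obtain ⟨w, hw, h3⟩ := exists_requiredPower_eq (N := N) hM hN hR hh hpos
  have h4 : requiredPower N R h (fun m => J m + d) ≤ charCurve N R h (j + d) := by
    refine requiredPower_le_charCurve hM hN hR hh hpos ?_
    rw [frameMean_add, hJ, frameMean_const hM]
  refine le_trans ?_ h4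
  rw [h1, h3]
  have h5 := requiredPower_le_ratePower hM hN hR hh hJ0 hw
  have h7 : d * (R / ∑ m, h m) ≤
      frameMean (fun m => d * ((Real.exp (R * M * w m) - 1) / h m)) := by
    rw [frameMean_const_mul]
    refine mul_le_mul_of_nonneg_left ?_ hd
    have hS : ∀ m, h m ≤ ∑ m, h m := fun m =>
      Finset.single_le_sum (fun i _ => (hh i).le) (Finset.mem_univ m)
    rw [show R / ∑ m, h m = frameMean (fun m => 1 / (∑ m, h m) * (R * M * w m)) by
      rw [frameMean_const_mul, frameMean_simplex hM R hw]; ring]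
    refine frameMean_mono fun m => ?_
    have h8 : R * M * w m ≤ Real.exp (R * M * w m) - 1 := by
      linarith [Real.add_one_le_exp (R * M * w m)]
    have h9 := hw.1 m
    rw [one_div_mul_eq_div]
    have := hh m
    calc R * M * w m / ∑ m, h m ≤ R * M * w m / h m := by
          gcongr
          exact hS m
      _ ≤ _ := by gcongr
  have h8 : ratePower N R h (fun m => J m + d) w = ratePower N R h J w +
      frameMean (fun m => d * ((Real.exp (R * M * w m) - 1) / h m)) := by
    unfold ratePower
    rw [← frameMean_add]
    congr 1
    ext m
    ring
  rw [h8]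
  linarith

include hM hN hR in
-- The transmitter may put the whole rate on the strongest block i, where M·h_i ≥ ∑ h and the
-- jamming is at most M·j.
theorem charCurve_upper {h : Fin M → ℝ} (hh : ∀ m, 0 < h m) {j : ℝ} (hj : 0 ≤ j) :
    charCurve N R h j ≤
      ((Real.exp (R * M) - 1) * N + (Real.exp (R * M) - 1) * M * j) / ∑ m, h m := by
  have hM' : (0 : ℝ) < M := by positivity
  obtain ⟨J, hJ0, hJ, h1⟩ := exists_charCurve_eq_requiredPower (N := N) hM hN hR hh hj
  have : Nonempty (Fin M) := ⟨⟨0, hM⟩⟩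
  obtain ⟨i, hi⟩ := Finite.exists_max h
  rw [h1]
  refine (requiredPower_le_ratePower hM hN hR hh hJ0 (single_mem_stdSimplex ℝ i)).trans ?_
  have hS : ∑ m, h m ≤ M * h i := by
    have := Finset.sum_le_card_nsmul Finset.univ h (h i) fun m _ => hi m
    simpa using this
  have hS0 : 0 < ∑ m, h m := Finset.sum_pos (fun m _ => hh m) Finset.univ_nonempty
  have hC : 0 ≤ Real.exp (R * M) - 1 := sub_nonneg.2 (Real.one_le_exp (by positivity))
  have h2 : ratePower N R h J (Pi.single i 1) =
      1 / M * ((N + J i) / h i * (Real.exp (R * M) - 1)) := by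
    unfold ratePower frameMean
    congr 1
    rw [Finset.sum_eq_single i]
    · simp
    · intro m _ hm
      simp [hm]
    · simp
  have h3 := le_mul_frameMean hM hJ0 i
  rw [hJ] at h3
  have h4 := hh i
  have h5 := hJ0 i
  rw [h2]
  calc 1 / M * ((N + J i) / h i * (Real.exp (R * M) - 1))
      = ((Real.exp (R * M) - 1) * (N + J i)) / (M * h i) := by field_simp
    _ ≤ ((Real.exp (R * M) - 1) * (N + J i)) / ∑ m, h m := by
        gcongr
    _ ≤ _ := by
        rw [show (Real.exp (R * M) - 1) * N + (Real.exp (R * M) - 1) * M * j =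
          (Real.exp (R * M) - 1) * (N + M * j) by ring]
        gcongr

include hM hN hR in
-- The transmitter keeps the rate fractions that are optimal without jamming. This makes the slope
-- at 0 finite, which concavity alone does not give.
theorem charCurve_linear {h : Fin M → ℝ} (hh : ∀ m, 0 < h m) {j : ℝ} (hj : 0 ≤ j) :
    charCurve N R h j ≤ charCurve N R h 0 + j * ∑ m, (Real.exp (R * M) - 1) / h m := by
  have hM' : (0 : ℝ) < M := by positivity
  obtain ⟨J, hJ0, hJ, h1⟩ := exists_charCurve_eq_requiredPower (N := N) hM hN hR hh hj
  obtain ⟨w, hw, h2⟩ := exists_requiredPower_eq (N := N) (J := fun _ => 0) hM hN hR hh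
    fun _ => le_rfl
  have h3 : requiredPower N R h (fun _ => 0) ≤ charCurve N R h 0 :=
    requiredPower_le_charCurve hM hN hR hh (fun _ => le_rfl) (frameMean_const hM 0).le
  have h4 : ratePower N R h J w = ratePower N R h (fun _ => 0) w +
      frameMean (fun m => J m * ((Real.exp (R * M * w m) - 1) / h m)) := by
    unfold ratePower
    rw [← frameMean_add]
    congr 1
    ext m
    ring
  have h5 : frameMean (fun m => J m * ((Real.exp (R * M * w m) - 1) / h m)) ≤
      j * ∑ m, (Real.exp (R * M) - 1) / h m := by
    have : j * ∑ m, (Real.exp (R * M) - 1) / h m =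
        frameMean fun m => (M * j) * ((Real.exp (R * M) - 1) / h m) := by
      rw [frameMean_const_mul]
      unfold frameMean
      field_simp
    rw [this]
    refine frameMean_mono fun m => ?_
    have h6 := le_mul_frameMean hM hJ0 m
    rw [hJ] at h6
    have h7 := hh m
    have h8 := hw.1 m
    have h9 : w m ≤ 1 := by
      rw [← hw.2]
      exact Finset.single_le_sum (fun i _ => hw.1 i) (Finset.mem_univ m)
    have h10 : R * M * w m ≤ R * M := mul_le_of_le_one_right (by positivity) h9
    have h11 : 0 ≤ Real.exp (R * M * w m) - 1 := sub_nonneg.2 (Real.one_le_exp (by positivity))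
    gcongr
  rw [h1]
  refine (requiredPower_le_ratePower hM hN hR hh hJ0 hw).trans ?_
  rw [h4]
  linarith

end Channel

/-! ### Measurable dependence on the frame -/

section Measurability

variable {M : ℕ} {N R : ℝ}

open Classical in
/-- The frame itself if all gains are positive, and a fixed frame otherwise. -/
noncomputable def regularize (h : Fin M → ℝ) : Fin M → ℝ :=
  if ∀ m, 0 < h m then h else fun _ => 1

theorem regularize_pos (h : Fin M → ℝ) (m : Fin M) : 0 < regularize h m := by
  unfold regularize
  split_ifs with hh
  · exact hh m
  · exact one_pos

theorem regularize_eq {h : Fin M → ℝ} (hh : ∀ m, 0 < h m) : regularize h = h := if_pos hh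

theorem measurable_regularize : Measurable (regularize : (Fin M → ℝ) → Fin M → ℝ) := by
  refine Measurable.ite ?_ measurable_id measurable_const
  simp only [ofPred_forall]
  exact MeasurableSet.iInter fun m => measurableSet_lt measurable_const (measurable_pi_apply m)

theorem ae_regularize_eq {μ : Measure (Fin M → ℝ)} (hdens : μ ≪ volume)
    (hpos : ∀ᵐ h ∂μ, ∀ m, 0 ≤ h m) : ∀ᵐ h ∂μ, regularize h = h := by
  have h1 : ∀ᵐ h ∂μ, ∀ m, h m ≠ 0 := by
    rw [ae_all_iff]
    intro m
    refine hdens.ae_le ?_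
    have : (volume : Measure (Fin M → ℝ)) {h | h m = 0} = 0 := by
      rw [volume_pi]
      exact Measure.pi_hyperplane _ m 0
    exact compl_mem_ae_iff.2 this
  filter_upwards [h1, hpos] with h h1 h2
  exact regularize_eq fun m => (h2 m).lt_of_ne (h1 m).symm

variable {Ω : Type*} [MeasurableSpace Ω]

theorem measurable_frameMean : Measurable (frameMean : (Fin M → ℝ) → ℝ) :=
  continuous_frameMean.measurable

theorem measurable_ratePower {h J w : Ω → Fin M → ℝ} (hh : Measurable h) (hJ : Measurable J)
    (hw : Measurable w) : Measurable fun ω => ratePower N R (h ω) (J ω) (w ω) := by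
  unfold ratePower frameMean
  fun_prop

/-- A measurable choice of optimal rate fractions. -/
theorem exists_measurable_rates (hM : 0 < M) {h J : Ω → Fin M → ℝ} (hh : Measurable h)
    (hJ : Measurable J) : ∃ w : Ω → Fin M → ℝ, Measurable w ∧
      (∀ ω, w ω ∈ stdSimplex ℝ (Fin M)) ∧ ∀ ω, ∀ w' ∈ stdSimplex ℝ (Fin M),
        ratePower N R (h ω) (J ω) (w ω) ≤ ratePower N R (h ω) (J ω) w' := by
  obtain ⟨w, h1, h2, h3⟩ := exists_measurable_argmax (isCompact_stdSimplex ℝ (Fin M))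
    (simplex_nonempty hM) (fun ω w => -ratePower N R (h ω) (J ω) w)
    (fun w => (measurable_ratePower hh hJ measurable_const).neg)
    (fun ω => ((continuous_ratePower (N := N) (R := R) (h ω)).comp
      (Continuous.prodMk_right (J ω))).neg)
  exact ⟨w, h1, h2, fun ω w' hw' => neg_le_neg_iff.1 (h3 ω w' hw')⟩

theorem measurable_minRatePower (hM : 0 < M) {h J : Ω → Fin M → ℝ} (hh : Measurable h)
    (hJ : Measurable J) : Measurable fun ω => minRatePower N R (h ω) (J ω) := by
  obtain ⟨w, h1, h2, h3⟩ := exists_measurable_rates (N := N) (R := R) hM hh hJ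
  have : (fun ω => minRatePower N R (h ω) (J ω)) = fun ω => ratePower N R (h ω) (J ω) (w ω) :=
    funext fun ω => minRatePower_eq_of_isMin (h2 ω) (h3 ω)
  rw [this]
  exact measurable_ratePower hh hJ h1

/-- A measurable choice of an optimal distribution of a frame power between the blocks. -/
theorem exists_measurable_jamming (hM : 0 < M) (hN : 0 < N) (hR : 0 < R) {h : Ω → Fin M → ℝ}
    (hh : Measurable h) (hh0 : ∀ ω m, 0 < h ω m) {j : Ω → ℝ} (hj : Measurable j)
    (hj0 : ∀ ω, 0 ≤ j ω) :
    ∃ J : Ω → Fin M → ℝ, Measurable J ∧ (∀ ω m, 0 ≤ J ω m) ∧ (∀ ω, frameMean (J ω) = j ω) ∧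
      ∀ ω, requiredPower N R (h ω) (J ω) = charCurve N R (h ω) (j ω) := by
  have hm : ∀ v : Fin M → ℝ,
      Measurable fun ω => minRatePower N R (h ω) (fun m => j ω * M * v m) := fun v => by
    have h0 : Measurable fun ω => (fun m => j ω * M * v m : Fin M → ℝ) := by fun_prop
    exact measurable_minRatePower hM hh h0
  have hc : ∀ ω, Continuous fun v : Fin M → ℝ =>
      minRatePower N R (h ω) (fun m => j ω * M * v m) := fun ω => by
    have h0 : Continuous fun v : Fin M → ℝ => (fun m => j ω * M * v m : Fin M → ℝ) :=
      continuous_pi fun m => (continuous_apply m).const_mul _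
    exact (continuous_minRatePower (h ω)).comp h0
  obtain ⟨v, h1, h2, h3⟩ := exists_measurable_argmax (isCompact_stdSimplex ℝ (Fin M))
    (simplex_nonempty hM) (fun ω v => minRatePower N R (h ω) (fun m => j ω * M * v m)) hm hc
  have hpos : ∀ ω m, 0 ≤ j ω * M * v ω m := fun ω m => by
    have := (h2 ω).1 m
    have := hj0 ω
    positivity
  have hv : Measurable fun ω => (fun m => j ω * M * v ω m : Fin M → ℝ) :=
    measurable_pi_lambda _ fun m =>
      (hj.mul_const _).mul ((measurable_pi_apply m).comp h1)
  refine ⟨fun ω m => j ω * M * v ω m, hv, hpos,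
    fun ω => frameMean_simplex hM (j ω) (h2 ω), fun ω => ?_⟩
  have h4 := charCurve_eq_of_isMax hM hN hR (hh0 ω) (hj0 ω) (h2 ω) (h3 ω)
  have h5 := requiredPower_eq_minRatePower hM hN hR (hh0 ω) (hpos ω)
  exact h5.trans h4.symm

theorem measurable_requiredPower (hM : 0 < M) (hN : 0 < N) (hR : 0 < R) {h J : Ω → Fin M → ℝ}
    (hh : Measurable h) (hh0 : ∀ ω m, 0 < h ω m) (hJ : Measurable J) (hJ0 : ∀ ω m, 0 ≤ J ω m) :
    Measurable fun ω => requiredPower N R (h ω) (J ω) := by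
  have : (fun ω => requiredPower N R (h ω) (J ω)) = fun ω => minRatePower N R (h ω) (J ω) :=
    funext fun ω => requiredPower_eq_minRatePower hM hN hR (hh0 ω) (hJ0 ω)
  rw [this]
  exact measurable_minRatePower hM hh hJ

/-- A measurable choice of transmitter powers that attain the required power. -/
theorem exists_measurable_response (hM : 0 < M) (hN : 0 < N) (hR : 0 < R) {h J : Ω → Fin M → ℝ}
    (hh : Measurable h) (hh0 : ∀ ω m, 0 < h ω m) (hJ : Measurable J) (hJ0 : ∀ ω m, 0 ≤ J ω m) :
    ∃ P : Ω → Fin M → ℝ, Measurable P ∧ (∀ ω m, 0 ≤ P ω m) ∧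
      (∀ ω, mutualInfo N (h ω) (P ω) (J ω) = R) ∧
      ∀ ω, frameMean (P ω) = requiredPower N R (h ω) (J ω) := by
  obtain ⟨w, h1, h2, h3⟩ := exists_measurable_rates (N := N) (R := R) hM hh hJ
  refine ⟨fun ω => blockPower N R (h ω) (J ω) (w ω), ?_,
    fun ω => blockPower_nonneg hN hR (hh0 ω) (hJ0 ω) (h2 ω),
    fun ω => mutualInfo_blockPower hM hN (hh0 ω) (hJ0 ω) (h2 ω),
    fun ω => (requiredPower_eq_of_isMin hM hN hR (hh0 ω) (hJ0 ω) (h2 ω) (h3 ω)).symm⟩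
  unfold blockPower
  fun_prop

/-- The allocation and level analysis uses only these properties of the channel, with the sum of the
gains as weight. -/
theorem isCurveFamily_charCurve (hM : 0 < M) (hN : 0 < N) (hR : 0 < R) :
    IsCurveFamily (fun h : Fin M → ℝ => charCurve N R (regularize h))
      (fun h => ∑ m, regularize h m) R ((Real.exp (R * M) - 1) * N)
      ((Real.exp (R * M) - 1) * M) := by
  have hM' : (0 : ℝ) < M := by positivity
  have hC : 0 < Real.exp (R * M) - 1 := sub_pos.2 (Real.one_lt_exp_iff.2 (by positivity))
  have : Nonempty (Fin M) := ⟨⟨0, hM⟩⟩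
  refine ⟨hR, by positivity, by positivity,
    fun h => Finset.sum_pos (fun m _ => regularize_pos h m) Finset.univ_nonempty,
    ?_, fun j hj => ?_, fun h => charCurve_concaveOn hM hN hR (regularize_pos h),
    fun h => charCurve_continuousOn hM hN hR (regularize_pos h), fun h j hj => ?_,
    fun h j d hj hd => charCurve_lower hM hN hR (regularize_pos h) hj hd,
    fun h j hj => charCurve_upper hM hN hR (regularize_pos h) hj,
    fun h => ⟨_, fun j hj => charCurve_linear hM hN hR (regularize_pos h) hj⟩⟩
  · have := measurable_regularize (M := M)
    fun_prop
  · obtain ⟨J, h1, h2, -, h3⟩ := exists_measurable_jamming hM hN hR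
      (measurable_regularize (M := M)) regularize_pos (measurable_const (a := j)) fun _ => hj
    have h4 : (fun h : Fin M → ℝ => charCurve N R (regularize h) j) =
        fun h => requiredPower N R (regularize h) (J h) := funext fun h => (h3 h).symm
    rw [h4]
    exact measurable_requiredPower hM hN hR measurable_regularize regularize_pos h1 h2
  · obtain ⟨J, -, -, h1⟩ := exists_charCurve_eq_requiredPower hM hN hR (regularize_pos h) hj
    rw [h1]
    exact requiredPower_nonneg

end Measurability

/-! ### Allocating the jamming power by a price -/

section Allocation

variable {Ω : Type*} [MeasurableSpace Ω] {f : Ω → ℝ → ℝ} {S : Ω → ℝ} {a A b : ℝ}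

/-- A function measurable in ω and continuous in t is jointly measurable; the curves are first
extended to negative t by their value at 0. -/
theorem IsCurveFamily.measurable_comp (hf : IsCurveFamily f S a A b) {j : Ω → ℝ}
    (hj : Measurable j) (hj0 : ∀ ω, 0 ≤ j ω) : Measurable fun ω => f ω (j ω) := by
  have h1 : Measurable (Function.uncurry fun (t : ℝ) ω => f ω (max t 0)) :=
    measurable_uncurry_of_continuous_of_measurable
      (fun ω => (hf.continuous ω).comp_continuous (by fun_prop) fun t => le_max_right t 0)
      (fun t => hf.measurable _ (le_max_right t 0))
  have h2 : (fun ω => f ω (j ω)) =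
      (Function.uncurry fun (t : ℝ) ω => f ω (max t 0)) ∘ fun ω => (j ω, ω) := by
    ext ω
    simp [max_eq_left (hj0 ω)]
  rw [h2]
  exact h1.comp (hj.prodMk measurable_id)

theorem IsCurveFamily.strictMono (hf : IsCurveFamily f S a A b) (ω : Ω) {j t : ℝ} (hj : 0 ≤ j)
    (hjt : j < t) : f ω j < f ω t := by
  have h1 := hf.lower ω j (t - j) hj (by linarith)
  rw [add_sub_cancel] at h1
  have h2 : 0 < (t - j) * (a / S ω) :=
    mul_pos (sub_pos.2 hjt) (div_pos hf.a_pos (hf.weight_pos ω))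
  linarith

theorem IsCurveFamily.mono (hf : IsCurveFamily f S a A b) (ω : Ω) {j t : ℝ} (hj : 0 ≤ j)
    (hjt : j ≤ t) : f ω j ≤ f ω t := by
  rcases hjt.eq_or_lt with rfl | h
  · exact le_rfl
  · exact (hf.strictMono ω hj h).le

/-- Least jamming power that lifts the curve to the level `K`. -/
noncomputable def reach (f : Ω → ℝ → ℝ) (K : ℝ) (ω : Ω) : ℝ :=
  sInf {j | 0 ≤ j ∧ K ≤ f ω j}

theorem IsCurveFamily.reach_spec (hf : IsCurveFamily f S a A b) (K : ℝ) (ω : Ω) :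
    0 ≤ reach f K ω ∧ K ≤ f ω (reach f K ω) := by
  have hcl : IsClosed {j | 0 ≤ j ∧ K ≤ f ω j} :=
    (hf.continuous ω).preimage_isClosed_of_isClosed isClosed_Ici isClosed_Ici (t := Ici K)
  have hS := hf.weight_pos ω
  have ha := hf.a_pos
  have hne : {j | 0 ≤ j ∧ K ≤ f ω j}.Nonempty := by
    refine ⟨|K| * S ω / a, by positivity, ?_⟩
    have h1 := hf.lower ω 0 (|K| * S ω / a) le_rfl (by positivity)
    have h2 := hf.nonneg ω 0 le_rfl
    rw [zero_add] at h1
    have h3 : |K| * S ω / a * (a / S ω) = |K| := by field_simp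
    have h4 := le_abs_self K
    linarith
  exact hcl.csInf_mem hne ⟨0, fun j hj => hj.1⟩

theorem IsCurveFamily.reach_le_iff (hf : IsCurveFamily f S a A b) {K t : ℝ} {ω : Ω} (ht : 0 ≤ t) :
    reach f K ω ≤ t ↔ K ≤ f ω t :=
  ⟨fun h => (hf.reach_spec K ω).2.trans (hf.mono ω (hf.reach_spec K ω).1 h),
    fun h => csInf_le ⟨0, fun _ hj => hj.1⟩ ⟨ht, h⟩⟩

theorem IsCurveFamily.measurable_reach (hf : IsCurveFamily f S a A b) (K : ℝ) :
    Measurable (reach f K) := by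
  refine measurable_of_Iic fun t => ?_
  rcases lt_or_ge t 0 with ht | ht
  · have : reach f K ⁻¹' Iic t = ∅ := by
      ext ω
      simp only [mem_preimage, mem_Iic, mem_empty_iff_false, iff_false, not_le]
      exact ht.trans_le (hf.reach_spec K ω).1
    rw [this]
    exact MeasurableSet.empty
  · have : reach f K ⁻¹' Iic t = {ω | K ≤ f ω t} := by
      ext ω
      exact hf.reach_le_iff ht
    rw [this]
    exact measurableSet_le measurable_const (hf.measurable t ht)

/-- Below `reach` the curve is under K, and continuity gives the endpoint. The case j = 0 is
excluded because the curve may already start above K. -/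
theorem IsCurveFamily.le_level_of_le_reach (hf : IsCurveFamily f S a A b) {K j : ℝ} {ω : Ω}
    (hj : 0 < j) (hjr : j ≤ reach f K ω) : f ω j ≤ K := by
  have hcj : Tendsto (f ω) (𝓝[<] j) (𝓝 (f ω j)) :=
    (((hf.continuous ω).continuousAt (Ici_mem_nhds hj)).tendsto).mono_left nhdsWithin_le_nhds
  refine le_of_tendsto hcj ?_
  filter_upwards [Ioo_mem_nhdsLT hj] with t ht
  by_contra! h
  have := (hf.reach_le_iff ht.1.le).2 h.le
  linarith [ht.2]

/-- The jamming power `j` maximizes the capped curve when power costs `l` per unit. -/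
def IsPriced (f : Ω → ℝ → ℝ) (K l : ℝ) (ω : Ω) (j : ℝ) : Prop :=
  0 ≤ j ∧ ∀ t, 0 ≤ t → min K (f ω t) - l * t ≤ min K (f ω j) - l * j

theorem IsCurveFamily.exists_priced (hf : IsCurveFamily f S a A b) {K l : ℝ} (hK : 0 < K)
    (hl : 0 < l) : ∃ j : Ω → ℝ, Measurable j ∧ ∀ ω, IsPriced f K l ω (j ω) := by
  have hKl : 0 ≤ K / l := by positivity
  -- Power beyond K/l costs more than the cap K can return, so a compact interval suffices.
  obtain ⟨j, h1, h2, h3⟩ := exists_measurable_argmax (isCompact_Icc (a := 0) (b := K / l))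
    (nonempty_Icc.2 hKl) (fun ω t => min K (f ω (max t 0)) - l * t)
    (fun t => ((measurable_const.min (hf.measurable _ (le_max_right t 0))).sub_const _))
    (fun ω => by
      have : Continuous fun t => f ω (max t 0) :=
        (hf.continuous ω).comp_continuous (by fun_prop) fun t => le_max_right t 0
      exact (continuous_const.min this).sub (continuous_const.mul continuous_id))
  refine ⟨j, h1, fun ω => ⟨(h2 ω).1, fun t ht => ?_⟩⟩
  have h4 : ∀ t ∈ Icc 0 (K / l), min K (f ω t) - l * t ≤ min K (f ω (j ω)) - l * j ω := by
    intro t ht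
    have := h3 ω t ht
    simpa only [max_eq_left ht.1, max_eq_left (h2 ω).1] using this
  rcases le_or_gt t (K / l) with h | h
  · exact h4 t ⟨ht, h⟩
  · have h5 := h4 0 ⟨le_rfl, hKl⟩
    have h6 : 0 ≤ min K (f ω 0) := le_min hK.le (hf.nonneg ω 0 le_rfl)
    have h7 := min_le_left K (f ω t)
    rw [div_lt_iff₀ hl] at h
    linarith

theorem IsPriced.le_div (hf : IsCurveFamily f S a A b) {K l j : ℝ} {ω : Ω} (hK : 0 < K)
    (hl : 0 < l) (h : IsPriced f K l ω j) : j ≤ K / l := by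
  have h5 := h.2 0 le_rfl
  have h6 : 0 ≤ min K (f ω 0) := le_min hK.le (hf.nonneg ω 0 le_rfl)
  have h7 := min_le_left K (f ω j)
  rw [le_div_iff₀ hl]
  linarith

omit [MeasurableSpace Ω] in
-- Adding the two optimality inequalities gives (l' − l)(j' − j) ≤ 0. The strict inequality of
-- prices makes this hold for any choice of maximizers.
theorem IsPriced.anti {K l l' j j' : ℝ} {ω : Ω} (hl : l < l') (h : IsPriced f K l ω j)
    (h' : IsPriced f K l' ω j') : j' ≤ j := by
  have h1 := h.2 j' h'.1
  have h2 := h'.2 j h.1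
  by_contra! h3
  nlinarith

theorem IsPriced.limit (hf : IsCurveFamily f S a A b) {K l j : ℝ} {ω : Ω} {ls js : ℕ → ℝ}
    (hl : Tendsto ls atTop (𝓝 l)) (hj : Tendsto js atTop (𝓝 j))
    (h : ∀ n, IsPriced f K (ls n) ω (js n)) : IsPriced f K l ω j := by
  have hj0 : 0 ≤ j := ge_of_tendsto' hj fun n => (h n).1
  have hfj : Tendsto (fun n => f ω (js n)) atTop (𝓝 (f ω j)) :=
    (hf.continuous ω j hj0).tendsto.comp
      (tendsto_nhdsWithin_iff.2 ⟨hj, Eventually.of_forall fun n => (h n).1⟩)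
  refine ⟨hj0, fun t ht => ?_⟩
  exact le_of_tendsto_of_tendsto' (tendsto_const_nhds.sub (hl.mul_const t))
    ((tendsto_const_nhds.min hfj).sub (hl.mul hj)) fun n => (h n).2 t ht

/-- The capped curve is concave, so its maximizers at a given price form an interval; this allows
the budget to be met exactly. -/
theorem IsPriced.convex (hf : IsCurveFamily f S a A b) {K l j k s t : ℝ} {ω : Ω}
    (hs : 0 ≤ s) (ht : 0 ≤ t) (hst : s + t = 1) (hj : IsPriced f K l ω j)
    (hk : IsPriced f K l ω k) : IsPriced f K l ω (s * j + t * k) := by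
  have h0j := hj.1
  have h0k := hk.1
  refine ⟨by positivity, fun u hu => ?_⟩
  have h1 := (hf.concave ω).2 h0j h0k hs ht hst
  simp only [smul_eq_mul] at h1
  have h2 := hj.2 u hu
  have h3 := hk.2 u hu
  have h4 : s * min K (f ω j) + t * min K (f ω k) ≤ min K (f ω (s * j + t * k)) := by
    refine le_min ?_ (le_trans ?_ h1)
    · have h5 := mul_le_mul_of_nonneg_left (min_le_left K (f ω j)) hs
      have h6 := mul_le_mul_of_nonneg_left (min_le_left K (f ω k)) ht
      have h7 : s * K + t * K = K := by rw [← add_mul, hst, one_mul]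
      linarith
    · gcongr <;> exact min_le_right _ _
  have h5 := mul_le_mul_of_nonneg_left h2 hs
  have h6 := mul_le_mul_of_nonneg_left h3 ht
  have h7 : s * (min K (f ω u) - l * u) + t * (min K (f ω u) - l * u) =
      min K (f ω u) - l * u := by rw [← add_mul, hst, one_mul]
  linarith

theorem IsPriced.le_reach (hf : IsCurveFamily f S a A b) {K l j : ℝ} {ω : Ω} (hl : 0 < l)
    (h : IsPriced f K l ω j) : j ≤ reach f K ω := by
  have h1 := h.2 _ (hf.reach_spec K ω).1
  rw [min_eq_left (hf.reach_spec K ω).2] at h1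
  have h2 := min_le_left K (f ω j)
  by_contra! h3
  nlinarith

theorem IsPriced.level (hf : IsCurveFamily f S a A b) {K l j : ℝ} {ω : Ω} (hl : 0 < l)
    (h : IsPriced f K l ω j) (hj : 0 < j) : f ω j ≤ K :=
  hf.le_level_of_le_reach hj (h.le_reach hf hl)

/-- When power is free, a maximizer must bring the capped curve to K. -/
theorem IsPriced.reach_le (hf : IsCurveFamily f S a A b) {K j : ℝ} {ω : Ω}
    (h : IsPriced f K 0 ω j) : reach f K ω ≤ j := by
  have h1 := h.2 _ (hf.reach_spec K ω).1
  rw [min_eq_left (hf.reach_spec K ω).2] at h1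
  rw [hf.reach_le_iff h.1]
  have := min_le_right K (f ω j)
  linarith

variable {μ : Measure Ω}

/-- A measurable allocation of nonnegative jamming powers with average at most `Jbar`. -/
structure IsAllocation (μ : Measure Ω) (Jbar : ℝ) (j : Ω → ℝ) : Prop where
  measurable : Measurable j
  nonneg : ∀ ω, 0 ≤ j ω
  integrable : Integrable j μ
  integral_le : ∫ ω, j ω ∂μ ≤ Jbar

/-- An allocation that spends the average power exactly, never lifts a curve above `K`, and
maximizes the capped curves for a common price unless all curves are lifted to `K`. -/
structure IsPricedAllocation (μ : Measure Ω) (f : Ω → ℝ → ℝ) (K Jbar : ℝ) (j : Ω → ℝ) : Prop where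
  allocation : IsAllocation μ Jbar j
  integral_eq : ∫ ω, j ω ∂μ = Jbar
  level : ∀ᵐ ω ∂μ, 0 < j ω → f ω (j ω) ≤ K
  priced : (∃ l, 0 < l ∧ ∀ᵐ ω ∂μ, IsPriced f K l ω (j ω)) ∨ ∀ᵐ ω ∂μ, K ≤ f ω (j ω)

variable [IsProbabilityMeasure μ]

theorem integrable_of_bounds {g : Ω → ℝ} {K : ℝ} (hg : Measurable g) (h0 : ∀ ω, 0 ≤ g ω)
    (hK : ∀ ω, g ω ≤ K) : Integrable g μ :=
  Integrable.of_bound hg.aestronglyMeasurable K (Eventually.of_forall fun ω => by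
    rw [Real.norm_eq_abs, abs_of_nonneg (h0 ω)]
    exact hK ω)

theorem integrable_min {g : Ω → ℝ} {K : ℝ} (hK : 0 ≤ K) (hg : Measurable g) (h0 : ∀ ω, 0 ≤ g ω) :
    Integrable (fun ω => min K (g ω)) μ :=
  integrable_of_bounds (measurable_const.min hg) (fun ω => le_min hK (h0 ω))
    fun _ => min_le_left _ _

theorem integral_tendsto_of_bounds {g : ℕ → Ω → ℝ} {g' : Ω → ℝ} {K : ℝ}
    (hg : ∀ n, Measurable (g n)) (h0 : ∀ n ω, 0 ≤ g n ω) (hK : ∀ n ω, g n ω ≤ K)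
    (hlim : ∀ ω, Tendsto (fun n => g n ω) atTop (𝓝 (g' ω))) :
    Tendsto (fun n => ∫ ω, g n ω ∂μ) atTop (𝓝 (∫ ω, g' ω ∂μ)) :=
  tendsto_integral_of_dominated_convergence (fun _ => K)
    (fun n => (hg n).aestronglyMeasurable) (integrable_const K)
    (fun n => Eventually.of_forall fun ω => by
      rw [Real.norm_eq_abs, abs_of_nonneg (h0 n ω)]
      exact hK n ω) (Eventually.of_forall hlim)

/-- A level is feasible when lifting all curves to it costs at least the available power. -/
def IsFeasible (μ : Measure Ω) (f : Ω → ℝ → ℝ) (Jbar K : ℝ) : Prop :=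
  0 < K ∧ ENNReal.ofReal Jbar ≤ ∫⁻ ω, ENNReal.ofReal (reach f K ω) ∂μ

/-- Spending decreases with the price, so there is a critical price `ls`. Limits of the selections
from above (`u`) and from below (`v`) are both priced at `ls` and spend at most and at least Jbar; a
convex combination spends Jbar. If `ls` is 0, then `u` is `reach` itself, and feasibility makes its
cost exactly Jbar. -/
theorem IsCurveFamily.exists_pricedAllocation (hf : IsCurveFamily f S a A b) {K Jbar : ℝ}
    (hJ : 0 < Jbar) (hfeas : IsFeasible μ f Jbar K) :
    ∃ j, IsPricedAllocation μ f K Jbar j := by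
  obtain ⟨hK, hfeas⟩ := hfeas
  have hex : ∀ l : ℝ, ∃ j : Ω → ℝ, Measurable j ∧ (0 < l → ∀ ω, IsPriced f K l ω (j ω)) := by
    intro l
    by_cases hl : 0 < l
    · obtain ⟨j, h1, h2⟩ := hf.exists_priced hK hl
      exact ⟨j, h1, fun _ => h2⟩
    · exact ⟨fun _ => 0, measurable_const, fun h => absurd h hl⟩
  choose p hpm hp using hex
  have hint : ∀ l, 0 < l → Integrable (p l) μ := fun l hl =>
    integrable_of_bounds (hpm l) (fun ω => (hp l hl ω).1) fun ω => (hp l hl ω).le_div hf hK hl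
  let C : Set ℝ := {l | 0 < l ∧ ∫ ω, p l ω ∂μ ≤ Jbar}
  -- At price K/Jbar each frame spends at most K/(K/Jbar) = Jbar.
  have hCne : K / Jbar ∈ C := by
    have hl : 0 < K / Jbar := by positivity
    refine ⟨hl, ?_⟩
    calc ∫ ω, p (K / Jbar) ω ∂μ ≤ ∫ _, Jbar ∂μ := by
          refine integral_mono (hint _ hl) (integrable_const _) fun ω => ?_
          have := (hp _ hl ω).le_div hf hK hl
          rwa [div_div_cancel₀ hK.ne'] at this
      _ = Jbar := by simp
  have hCbdd : BddBelow C := ⟨0, fun l hl => hl.1.le⟩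
  let ls := sInf C
  have hls : 0 ≤ ls := le_csInf ⟨_, hCne⟩ fun l hl => hl.1.le
  have habove : ∀ l, ls < l → l ∈ C := by
    intro l hl
    obtain ⟨l', hl', hlt⟩ := exists_lt_of_csInf_lt ⟨_, hCne⟩ hl
    have h0 : 0 < l := hls.trans_lt hl
    exact ⟨h0, (integral_mono (hint l h0) (hint l' hl'.1) fun ω =>
      IsPriced.anti hlt (hp l' hl'.1 ω) (hp l h0 ω)).trans hl'.2⟩
  let r : ℕ → ℝ := fun n => ls + 1 / ((n : ℝ) + 1)
  have hr : ∀ n, ls < r n := fun n => lt_add_of_pos_right _ (by positivity)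
  have hr0 : ∀ n, 0 < r n := fun n => hls.trans_lt (hr n)
  have hranti : StrictAnti r := fun m n hmn => by
    simp only [r]
    gcongr
  have hrlim : Tendsto r atTop (𝓝 ls) := by
    simpa [r] using tendsto_one_div_add_atTop_nhds_zero_nat.const_add ls
  have humono : ∀ ω, Monotone fun n => p (r n) ω := fun ω m n hmn => by
    rcases hmn.eq_or_lt with rfl | hmn
    · exact le_rfl
    · exact IsPriced.anti (hranti hmn) (hp _ (hr0 n) ω) (hp _ (hr0 m) ω)
  have hubdd : ∀ ω, BddAbove (range fun n => p (r n) ω) := fun ω =>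
    ⟨reach f K ω, by
      rintro _ ⟨n, rfl⟩
      exact (hp _ (hr0 n) ω).le_reach hf (hr0 n)⟩
  let u : Ω → ℝ := fun ω => ⨆ n, p (r n) ω
  have hulim : ∀ ω, Tendsto (fun n => p (r n) ω) atTop (𝓝 (u ω)) := fun ω =>
    tendsto_atTop_ciSup (humono ω) (hubdd ω)
  have hum : Measurable u := measurable_of_tendsto_metrizable (fun n => hpm (r n))
    (tendsto_pi_nhds.2 hulim)
  have hup : ∀ ω, IsPriced f K ls ω (u ω) := fun ω =>
    IsPriced.limit hf hrlim (hulim ω) fun n => hp _ (hr0 n) ω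
  rcases hls.eq_or_lt with hls0 | hls0
  · have hur : ∀ ω, u ω = reach f K ω := fun ω => by
      refine le_antisymm (ciSup_le fun n => (hp _ (hr0 n) ω).le_reach hf (hr0 n)) ?_
      have := hup ω
      rw [← hls0] at this
      exact this.reach_le hf
    have hlint : ∫⁻ ω, ENNReal.ofReal (u ω) ∂μ = ENNReal.ofReal Jbar := by
      refine le_antisymm ?_ ?_
      · have h1 : Tendsto (fun n => ∫⁻ ω, ENNReal.ofReal (p (r n) ω) ∂μ) atTop
            (𝓝 (∫⁻ ω, ENNReal.ofReal (u ω) ∂μ)) :=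
          lintegral_tendsto_of_tendsto_of_monotone
            (fun n => (hpm (r n)).ennreal_ofReal.aemeasurable)
            (Eventually.of_forall fun ω m n hmn => ENNReal.ofReal_le_ofReal (humono ω hmn))
            (Eventually.of_forall fun ω => ENNReal.tendsto_ofReal (hulim ω))
        refine le_of_tendsto' h1 fun n => ?_
        rw [← ofReal_integral_eq_lintegral_ofReal (hint _ (hr0 n))
          (Eventually.of_forall fun ω => (hp _ (hr0 n) ω).1)]
        exact ENNReal.ofReal_le_ofReal (habove _ (hr n)).2
      · simpa only [hur] using hfeas
    have hu0 : 0 ≤ᵐ[μ] u := Eventually.of_forall fun ω => (hup ω).1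
    have huint : Integrable u μ := by
      refine ⟨hum.aestronglyMeasurable, ?_⟩
      rw [hasFiniteIntegral_iff_ofReal hu0, hlint]
      exact ENNReal.ofReal_lt_top
    have hueq : ∫ ω, u ω ∂μ = Jbar := by
      rw [integral_eq_lintegral_of_nonneg_ae hu0 hum.aestronglyMeasurable, hlint,
        ENNReal.toReal_ofReal hJ.le]
    refine ⟨u, ⟨hum, fun ω => (hup ω).1, huint, hueq.le⟩, hueq,
      Eventually.of_forall fun ω h => hf.le_level_of_le_reach h (hur ω).le,
      Or.inr (Eventually.of_forall fun ω => ?_)⟩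
    rw [hur]
    exact (hf.reach_spec K ω).2
  -- The shift by 2 keeps these prices above `ls`/2, so the allocations share the bound K/(`ls`/2)
  -- needed for dominated convergence.
  · let q : ℕ → ℝ := fun n => ls - ls / ((n : ℝ) + 2)
    have hq2 : ∀ n, ls / 2 ≤ q n := fun n => by
      have : ls / ((n : ℝ) + 2) ≤ ls / 2 := by
        gcongr
        linarith [(Nat.cast_nonneg n : (0 : ℝ) ≤ n)]
      simp only [q]
      linarith
    have hq0 : ∀ n, 0 < q n := fun n => (half_pos hls0).trans_le (hq2 n)
    have hqlt : ∀ n, q n < ls := fun n => sub_lt_self _ (by positivity)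
    have hqmono : StrictMono q := fun m n hmn => by
      simp only [q]
      gcongr
    have hqlim : Tendsto q atTop (𝓝 ls) := by
      have h1 : Tendsto (fun n : ℕ => ls / ((n : ℝ) + 2)) atTop (𝓝 0) :=
        tendsto_const_nhds.div_atTop
          (tendsto_atTop_add_const_right _ _ tendsto_natCast_atTop_atTop)
      simpa [q] using h1.const_sub ls
    have hvanti : ∀ ω, Antitone fun n => p (q n) ω := fun ω m n hmn => by
      rcases hmn.eq_or_lt with rfl | hmn
      · exact le_rfl
      · exact IsPriced.anti (hqmono hmn) (hp _ (hq0 m) ω) (hp _ (hq0 n) ω)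
    let v : Ω → ℝ := fun ω => ⨅ n, p (q n) ω
    have hvlim : ∀ ω, Tendsto (fun n => p (q n) ω) atTop (𝓝 (v ω)) := fun ω =>
      tendsto_atTop_ciInf (hvanti ω) ⟨0, by
        rintro _ ⟨n, rfl⟩
        exact (hp _ (hq0 n) ω).1⟩
    have hvm : Measurable v := measurable_of_tendsto_metrizable (fun n => hpm (q n))
      (tendsto_pi_nhds.2 hvlim)
    have hvp : ∀ ω, IsPriced f K ls ω (v ω) := fun ω =>
      IsPriced.limit hf hqlim (hvlim ω) fun n => hp _ (hq0 n) ω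
    have huint : Integrable u μ := integrable_of_bounds hum (fun ω => (hup ω).1) fun ω =>
      (hup ω).le_div hf hK hls0
    have hvint : Integrable v μ := integrable_of_bounds hvm (fun ω => (hvp ω).1) fun ω =>
      (hvp ω).le_div hf hK hls0
    have hu1 : ∫ ω, u ω ∂μ ≤ Jbar := by
      refine le_of_tendsto' (integral_tendsto_of_bounds (K := K / ls) (fun n => hpm (r n))
        (fun n ω => (hp _ (hr0 n) ω).1) (fun n ω => ?_) hulim) fun n => (habove _ (hr n)).2
      exact ((hp _ (hr0 n) ω).le_div hf hK (hr0 n)).trans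
        (div_le_div_of_nonneg_left hK.le hls0 (hr n).le)
    have hv1 : Jbar ≤ ∫ ω, v ω ∂μ := by
      refine ge_of_tendsto' (integral_tendsto_of_bounds (K := K / (ls / 2)) (fun n => hpm (q n))
        (fun n ω => (hp _ (hq0 n) ω).1) (fun n ω => ?_) hvlim) fun n => ?_
      · exact ((hp _ (hq0 n) ω).le_div hf hK (hq0 n)).trans
          (div_le_div_of_nonneg_left hK.le (half_pos hls0) (hq2 n))
      · by_contra! h
        exact (notMem_of_lt_csInf (hqlt n) hCbdd) ⟨hq0 n, h.le⟩
    obtain ⟨s, t, hs, ht, hst, hcomb⟩ : ∃ s t : ℝ, 0 ≤ s ∧ 0 ≤ t ∧ s + t = 1 ∧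
        s * ∫ ω, u ω ∂μ + t * ∫ ω, v ω ∂μ = Jbar := by
      have h0 : Jbar ∈ Icc (∫ ω, u ω ∂μ) (∫ ω, v ω ∂μ) := ⟨hu1, hv1⟩
      rw [← segment_eq_Icc (hu1.trans hv1)] at h0
      obtain ⟨s, t, hs, ht, hst, h⟩ := h0
      exact ⟨s, t, hs, ht, hst, h⟩
    have hw : ∀ ω, IsPriced f K ls ω (s * u ω + t * v ω) := fun ω =>
      IsPriced.convex hf hs ht hst (hup ω) (hvp ω)
    have heq : ∫ ω, (s * u ω + t * v ω) ∂μ = Jbar := by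
      rw [integral_add (huint.const_mul s) (hvint.const_mul t), integral_const_mul,
        integral_const_mul, hcomb]
    exact ⟨fun ω => s * u ω + t * v ω, ⟨by fun_prop, fun ω => (hw ω).1,
      (huint.const_mul s).add (hvint.const_mul t), heq.le⟩, heq,
      Eventually.of_forall fun _ h => (hw _).level hf hls0 h,
      Or.inl ⟨ls, hls0, Eventually.of_forall hw⟩⟩

end Allocation

/-! ### The capped value as a function of the level -/

section Value

variable {Ω : Type*} [MeasurableSpace Ω] {f : Ω → ℝ → ℝ} {S : Ω → ℝ} {a A b : ℝ}
  {μ : Measure Ω} [IsProbabilityMeasure μ] {K Jbar : ℝ}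

theorem IsCurveFamily.integrable_capped (hf : IsCurveFamily f S a A b) (hK : 0 ≤ K) {j : Ω → ℝ}
    (hj : Measurable j) (hj0 : ∀ ω, 0 ≤ j ω) : Integrable (fun ω => min K (f ω (j ω))) μ :=
  integrable_min hK (hf.measurable_comp hj hj0) fun ω => hf.nonneg ω _ (hj0 ω)

/-- A priced allocation maximizes the average capped curve. -/
theorem IsPricedAllocation.capped_le (hf : IsCurveFamily f S a A b) (hK : 0 < K) {j k : Ω → ℝ}
    (hj : IsPricedAllocation μ f K Jbar j) (hk : IsAllocation μ Jbar k) :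
    ∫ ω, min K (f ω (k ω)) ∂μ ≤ ∫ ω, min K (f ω (j ω)) ∂μ := by
  have hji := hf.integrable_capped (μ := μ) hK.le hj.allocation.measurable hj.allocation.nonneg
  have hki := hf.integrable_capped (μ := μ) hK.le hk.measurable hk.nonneg
  rcases hj.priced with ⟨l, hl, h⟩ | h
  · have h1 : ∫ ω, (min K (f ω (k ω)) - l * k ω) ∂μ ≤ ∫ ω, (min K (f ω (j ω)) - l * j ω) ∂μ := by
      refine integral_mono_ae (hki.sub (hk.integrable.const_mul l))
        (hji.sub (hj.allocation.integrable.const_mul l)) ?_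
      filter_upwards [h] with ω hω
      exact hω.2 _ (hk.nonneg ω)
    rw [integral_sub hki (hk.integrable.const_mul l),
      integral_sub hji (hj.allocation.integrable.const_mul l), integral_const_mul,
      integral_const_mul, hj.integral_eq] at h1
    have h2 := mul_le_mul_of_nonneg_left hk.integral_le hl.le
    linarith
  · refine integral_mono_ae hki hji ?_
    filter_upwards [h] with ω hω
    simp only [min_eq_left hω]
    exact min_le_left _ _

omit [IsProbabilityMeasure μ] in
/-- Where a priced allocation leaves a curve below the level, its slope is at most any slope at
which power was spent. -/
theorem IsPricedAllocation.steepest (hf : IsCurveFamily f S a A b) {j : Ω → ℝ}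
    (hj : IsPricedAllocation μ f K Jbar j) :
    ∀ᵐ ω₁ ∂μ, ∀ᵐ ω₂ ∂μ, f ω₁ (j ω₁) < K → ∀ t, 0 ≤ t → t < j ω₂ →
      derivWithin (f ω₁) (Ioi (j ω₁)) (j ω₁) ≤ derivWithin (f ω₂) (Ioi t) t := by
  rcases hj.priced with ⟨l, hl, h⟩ | h
  · filter_upwards [h] with ω₁ h₁
    filter_upwards [h] with ω₂ h₂ hlt t ht htj
    obtain ⟨B₁, hB₁⟩ := hf.linear ω₁
    obtain ⟨B₂, hB₂⟩ := hf.linear ω₂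
    -- The price separates the slopes: going beyond `j ω₁` does not pay at price l, while going from
    -- t to `j ω₂` did.
    trans l
    · refine right_slope_le (hf.concave ω₁) hB₁ h₁.1 ?_
      have hc : Tendsto (f ω₁) (𝓝[>] (j ω₁)) (𝓝 (f ω₁ (j ω₁))) :=
        (hf.continuous ω₁ _ h₁.1).mono_left (nhdsWithin_mono _ fun t ht => h₁.1.trans ht.le)
      filter_upwards [hc.eventually_lt_const hlt, self_mem_nhdsWithin] with t h1 h2
      have h3 := h₁.2 t (h₁.1.trans (le_of_lt h2))
      rw [min_eq_right h1.le, min_eq_right hlt.le] at h3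
      linarith
    · have h1 := h₂.level hf hl (ht.trans_lt htj)
      have h2 := hf.mono ω₂ ht htj.le
      have h3 := h₂.2 t ht
      rw [min_eq_right h1, min_eq_right (h2.trans h1)] at h3
      exact le_right_slope (hf.concave ω₂) hB₂ ht htj (by linarith)
  · filter_upwards [h] with ω₁ h₁
    exact Eventually.of_forall fun ω₂ hlt => absurd hlt h₁.not_gt

omit [IsProbabilityMeasure μ] in
theorem ae_eq_of_ae_le_of_integral_eq {g k : Ω → ℝ} (hle : g ≤ᵐ[μ] k) (hg : Integrable g μ)
    (hk : Integrable k μ) (h : ∫ ω, g ω ∂μ = ∫ ω, k ω ∂μ) : g =ᵐ[μ] k :=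
  (integral_eq_iff_of_ae_le hg hk hle).1 h

omit [IsProbabilityMeasure μ] in
/-- A steepest-slope filling is a priced allocation. -/
theorem IsCurveFamily.pricedAllocation_of_steepest (hf : IsCurveFamily f S a A b) (hJ : 0 < Jbar)
    {j : Ω → ℝ} (hj : IsAllocation μ Jbar j) (heq : ∫ ω, j ω ∂μ = Jbar)
    (hlevel : ∀ᵐ ω ∂μ, 0 < j ω → f ω (j ω) ≤ K)
    (hsteep : ∀ᵐ ω₁ ∂μ, ∀ᵐ ω₂ ∂μ, f ω₁ (j ω₁) < K → ∀ t, 0 ≤ t → t < j ω₂ →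
      derivWithin (f ω₁) (Ioi (j ω₁)) (j ω₁) ≤ derivWithin (f ω₂) (Ioi t) t) :
    IsPricedAllocation μ f K Jbar j := by
  refine ⟨hj, heq, hlevel, ?_⟩
  by_cases hnull : ∀ᵐ ω ∂μ, K ≤ f ω (j ω)
  · exact Or.inr hnull
  left
  let s : Ω → ℝ → ℝ := fun ω t => derivWithin (f ω) (Ioi t) t
  let G : Set Ω := {ω₁ | f ω₁ (j ω₁) < K ∧ ∀ᵐ ω₂ ∂μ, ∀ t, 0 ≤ t → t < j ω₂ →
    s ω₁ (j ω₁) ≤ s ω₂ t}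
  have hG : ∀ᵐ ω ∂μ, f ω (j ω) < K → ω ∈ G := by
    filter_upwards [hsteep] with ω₁ h hlt
    exact ⟨hlt, h.mono fun ω₂ h' => h' hlt⟩
  have hGne : G.Nonempty := by
    by_contra! hGe
    refine hnull (hG.mono fun ω h => ?_)
    by_contra! hlt
    have := h hlt
    rw [hGe] at this
    exact this
  -- As Jbar > 0, a non-null set of curves receives power and has initial slope below a common n. By
  -- the steepest-slope rule this bounds the slopes on `G`, whose supremum is the price.
  obtain ⟨n, hn⟩ : ∃ n : ℕ, ∃ᵐ ω ∂μ, 0 < j ω ∧ s ω 0 ≤ n := by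
    by_contra! hcon
    have h1 : ∀ᵐ ω ∂μ, j ω = 0 := by
      filter_upwards [ae_all_iff.2 hcon] with ω h
      refine le_antisymm ?_ (hj.nonneg ω)
      by_contra! h0
      obtain ⟨n, hn⟩ := exists_nat_ge (s ω 0)
      exact (h n h0).not_ge hn
    rw [integral_congr_ae h1, integral_zero] at heq
    exact hJ.ne heq
  have hbdd : BddAbove ((fun ω => s ω (j ω)) '' G) := by
    refine ⟨n, ?_⟩
    rintro _ ⟨ω₁, h₁, rfl⟩
    obtain ⟨ω₂, ⟨h2, h3⟩, h4⟩ := (hn.and_eventually h₁.2).exists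
    exact (h4 0 le_rfl h2).trans h3
  let l := sSup ((fun ω => s ω (j ω)) '' G)
  have hle : ∀ ω ∈ G, s ω (j ω) ≤ l := fun ω h => le_csSup hbdd ⟨ω, h, rfl⟩
  have hge : ∀ᵐ ω₂ ∂μ, ∀ t, 0 ≤ t → t < j ω₂ → l ≤ s ω₂ t := by
    -- Each point of `G` brings its own null set; a sequence approaching the supremum leaves only
    -- countably many.
    obtain ⟨x, -, hx, hxG⟩ := exists_seq_tendsto_sSup (hGne.image fun ω => s ω (j ω)) hbdd
    choose y hyG hy using hxG
    filter_upwards [ae_all_iff.2 fun n => (hyG n).2] with ω₂ h t ht htj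
    exact le_of_tendsto' hx fun n => (hy n) ▸ h n t ht htj
  have hspos : ∀ ω t, 0 ≤ t → 0 < s ω t := by
    intro ω t ht
    obtain ⟨B, hB⟩ := hf.linear ω
    refine (div_pos hf.a_pos (hf.weight_pos ω)).trans_le ?_
    refine le_right_slope (hf.concave ω) hB ht (lt_add_one t) ?_
    have := hf.lower ω t 1 ht zero_le_one
    linarith
  have hl : 0 < l := by
    obtain ⟨ω, hω⟩ := hGne
    exact (hspos ω _ (hj.nonneg ω)).trans_le (hle ω hω)
  refine ⟨l, hl, ?_⟩
  filter_upwards [hG, hge, hlevel] with ω h1 h2 h3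
  obtain ⟨B, hB⟩ := hf.linear ω
  refine ⟨hj.nonneg ω, fun t ht => ?_⟩
  rcases lt_trichotomy t (j ω) with htj | rfl | htj
  · have h4 := secant_ge_of_right_slope_ge (hf.concave ω) hB (hf.continuous ω) ht htj h2
    rw [min_eq_right (h3 (ht.trans_lt htj))]
    have := min_le_right K (f ω t)
    linarith
  · exact le_rfl
  · rcases lt_or_ge (f ω (j ω)) K with h5 | h5
    · rw [min_eq_right h5.le]
      have h6 := le_right_tangent (hf.concave ω) hB (hj.nonneg ω) htj.le
      have h7 := mul_le_mul_of_nonneg_right (hle ω (h1 h5)) (sub_pos.2 htj).le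
      have h8 := min_le_right K (f ω t)
      simp only [s] at h7
      linarith
    · rw [min_eq_left h5]
      have h7 := mul_lt_mul_of_pos_left htj hl
      have h8 := min_le_left K (f ω t)
      linarith

/-- An allocation that is as good as a priced allocation, together with powers `p` below its
curves, is itself priced, and `p` attains the curves. -/
theorem IsPricedAllocation.of_capped_ge (hf : IsCurveFamily f S a A b) (hK : 0 < K)
    {j k p : Ω → ℝ} (hk : IsPricedAllocation μ f K Jbar k) (hj : IsAllocation μ Jbar j)
    (hp : Measurable p) (hp0 : ∀ ω, 0 ≤ p ω) (hpf : ∀ ω, p ω ≤ f ω (j ω))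
    (hpz : ∀ ω, j ω = 0 → p ω = f ω (j ω))
    (hge : ∫ ω, min K (f ω (k ω)) ∂μ ≤ ∫ ω, min K (p ω) ∂μ) :
    IsPricedAllocation μ f K Jbar j ∧ ∀ᵐ ω ∂μ, p ω = f ω (j ω) := by
  have hki := hf.integrable_capped (μ := μ) hK.le hk.allocation.measurable hk.allocation.nonneg
  have hpi : Integrable (fun ω => min K (p ω)) μ := integrable_min hK.le hp hp0
  rcases hk.priced with ⟨l, hl, h⟩ | h
  · have hj1 := hj.integrable.const_mul l
    have hk1 := hk.allocation.integrable.const_mul l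
    have hjl := mul_le_mul_of_nonneg_left hj.integral_le hl.le
    -- The priced maximum dominates pointwise, while the assumption on the averages forces equal
    -- integrals. Hence equality holds almost everywhere and `j` also maximizes at price l.
    have hle : ∀ᵐ ω ∂μ, min K (p ω) - l * j ω ≤ min K (f ω (k ω)) - l * k ω := by
      filter_upwards [h] with ω hω
      have h1 := hω.2 _ (hj.nonneg ω)
      have h2 : min K (p ω) ≤ min K (f ω (j ω)) := min_le_min_left K (hpf ω)
      linarith
    have hint : ∫ ω, (min K (f ω (k ω)) - l * k ω) ∂μ = ∫ ω, min K (f ω (k ω)) ∂μ - l * Jbar := by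
      rw [integral_sub hki hk1, integral_const_mul, hk.integral_eq]
    have hint' : ∫ ω, (min K (p ω) - l * j ω) ∂μ =
        ∫ ω, min K (p ω) ∂μ - l * ∫ ω, j ω ∂μ := by
      rw [integral_sub hpi hj1, integral_const_mul]
    have hmono := integral_mono_ae (hpi.sub hj1) (hki.sub hk1) hle
    simp only [Pi.sub_apply] at hmono
    rw [hint, hint'] at hmono
    have hJeq : ∫ ω, j ω ∂μ = Jbar := by
      refine le_antisymm hj.integral_le ?_
      have : l * Jbar ≤ l * ∫ ω, j ω ∂μ := by linarith
      exact le_of_mul_le_mul_left this hl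
    have hae : (fun ω => min K (p ω) - l * j ω) =ᵐ[μ] fun ω => min K (f ω (k ω)) - l * k ω := by
      refine ae_eq_of_ae_le_of_integral_eq hle (hpi.sub hj1) (hki.sub hk1) ?_
      rw [hint, hint', hJeq]
      rw [hJeq] at hmono
      linarith
    have hpr : ∀ᵐ ω ∂μ, IsPriced f K l ω (j ω) ∧ min K (p ω) = min K (f ω (j ω)) := by
      filter_upwards [h, hae] with ω h1 h2
      have h3 := h1.2 _ (hj.nonneg ω)
      have h4 : min K (p ω) ≤ min K (f ω (j ω)) := min_le_min_left K (hpf ω)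
      refine ⟨⟨hj.nonneg ω, fun t ht => ?_⟩, ?_⟩
      · have := h1.2 t ht
        linarith
      · linarith
    refine ⟨⟨hj, hJeq, ?_, Or.inl ⟨l, hl, hpr.mono fun ω h => h.1⟩⟩, ?_⟩
    · filter_upwards [hpr] with ω h1 h2
      exact h1.1.level hf hl h2
    · filter_upwards [hpr] with ω h1
      rcases (hj.nonneg ω).eq_or_lt with h0 | h0
      -- Without jamming the curve may exceed K, and equality of capped values would then say
      -- nothing about p.
      · exact hpz ω h0.symm
      · have h2 := h1.1.level hf hl h0
        have h3 := h1.2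
        rwa [min_eq_right h2, min_eq_right ((hpf ω).trans h2)] at h3
  · have h1 : (fun ω => min K (p ω)) =ᵐ[μ] fun _ => K := by
      refine ae_eq_of_ae_le_of_integral_eq (Eventually.of_forall fun ω => min_le_left _ _) hpi
        (integrable_const K) (le_antisymm (integral_mono hpi (integrable_const K)
          fun ω => min_le_left _ _) (le_trans (le_of_eq ?_) hge))
      refine (integral_congr_ae ?_).symm
      filter_upwards [h] with ω hω
      exact min_eq_left hω
    -- Both allocations reach K almost everywhere and `k` does so with the least power; the common
    -- budget then forces them to agree.
    have h2 : ∀ᵐ ω ∂μ, k ω ≤ j ω := by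
      filter_upwards [h1, hk.level] with ω h3 h4
      rcases (hk.allocation.nonneg ω).eq_or_lt with h0 | h0
      · rw [← h0]
        exact hj.nonneg ω
      · have h5 := h4 h0
        have h6 : K ≤ p ω := min_eq_left_iff.1 h3
        by_contra! hlt
        have := hf.strictMono ω (hj.nonneg ω) hlt
        linarith [hpf ω]
    have hJeq : ∫ ω, j ω ∂μ = Jbar := by
      refine le_antisymm hj.integral_le ?_
      rw [← hk.integral_eq]
      exact integral_mono_ae hk.allocation.integrable hj.integrable h2
    have h3 : k =ᵐ[μ] j := ae_eq_of_ae_le_of_integral_eq h2 hk.allocation.integrable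
      hj.integrable (hk.integral_eq.trans hJeq.symm)
    have hlevel : ∀ᵐ ω ∂μ, 0 < j ω → f ω (j ω) ≤ K := by
      filter_upwards [h3, hk.level] with ω h4 h5
      rwa [h4] at h5
    refine ⟨⟨hj, hJeq, hlevel, Or.inr ?_⟩, ?_⟩
    · filter_upwards [h3, h] with ω h4 h5
      rwa [h4] at h5
    · filter_upwards [h1, hlevel] with ω h4 h5
      rcases (hj.nonneg ω).eq_or_lt with h0 | h0
      · exact hpz ω h0.symm
      · exact le_antisymm (hpf ω) ((h5 h0).trans (min_eq_left_iff.1 h4))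

/-- The largest average capped curve that an allocation can enforce. -/
noncomputable def cappedValue (μ : Measure Ω) (f : Ω → ℝ → ℝ) (Jbar K : ℝ) : ℝ :=
  sSup {v | ∃ j, IsAllocation μ Jbar j ∧ v = ∫ ω, min K (f ω (j ω)) ∂μ}

omit [IsProbabilityMeasure μ] in
theorem isAllocation_zero (hJ : 0 < Jbar) : IsAllocation μ Jbar fun _ => 0 :=
  ⟨measurable_const, fun _ => le_rfl, integrable_zero _ _ _, by simpa using hJ.le⟩

theorem IsCurveFamily.capped_le_level (hf : IsCurveFamily f S a A b) (hK : 0 ≤ K) {j : Ω → ℝ}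
    (hj : IsAllocation μ Jbar j) : ∫ ω, min K (f ω (j ω)) ∂μ ≤ K := by
  have := integral_mono (hf.integrable_capped (μ := μ) hK hj.measurable hj.nonneg)
    (integrable_const K) fun ω => min_le_left K (f ω (j ω))
  simpa using this

theorem IsCurveFamily.capped_le_value (hf : IsCurveFamily f S a A b) (hK : 0 ≤ K) {j : Ω → ℝ}
    (hj : IsAllocation μ Jbar j) : ∫ ω, min K (f ω (j ω)) ∂μ ≤ cappedValue μ f Jbar K := by
  refine le_csSup ⟨K, ?_⟩ ⟨j, hj, rfl⟩
  rintro _ ⟨k, hk, rfl⟩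
  exact hf.capped_le_level hK hk

omit [IsProbabilityMeasure μ] in
theorem cappedValue_le (hJ : 0 < Jbar) {c : ℝ}
    (h : ∀ j, IsAllocation μ Jbar j → ∫ ω, min K (f ω (j ω)) ∂μ ≤ c) :
    cappedValue μ f Jbar K ≤ c := by
  refine csSup_le ⟨_, _, isAllocation_zero hJ, rfl⟩ ?_
  rintro _ ⟨k, hk, rfl⟩
  exact h k hk

theorem IsPricedAllocation.cappedValue_eq (hf : IsCurveFamily f S a A b) (hJ : 0 < Jbar)
    (hK : 0 < K) {j : Ω → ℝ} (hj : IsPricedAllocation μ f K Jbar j) :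
    cappedValue μ f Jbar K = ∫ ω, min K (f ω (j ω)) ∂μ :=
  le_antisymm (cappedValue_le hJ fun _ hk => hj.capped_le hf hK hk)
    (hf.capped_le_value hK.le hj.allocation)

theorem IsCurveFamily.cappedValue_mono (hf : IsCurveFamily f S a A b) (hJ : 0 < Jbar) {K' : ℝ}
    (hK : 0 ≤ K) (hKK : K ≤ K') : cappedValue μ f Jbar K ≤ cappedValue μ f Jbar K' :=
  cappedValue_le hJ fun _ hj =>
    (integral_mono (hf.integrable_capped hK hj.measurable hj.nonneg)
      (hf.integrable_capped (hK.trans hKK) hj.measurable hj.nonneg)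
      fun _ => min_le_min_right _ hKK).trans (hf.capped_le_value (hK.trans hKK) hj)

/-- Raising the cap raises a capped curve by no more than the cap itself; with monotonicity this
makes the value 1-Lipschitz. -/
theorem IsCurveFamily.cappedValue_le_add (hf : IsCurveFamily f S a A b) (hJ : 0 < Jbar) {K' : ℝ}
    (hK : 0 ≤ K) (hKK : K ≤ K') :
    cappedValue μ f Jbar K' ≤ cappedValue μ f Jbar K + (K' - K) := by
  refine cappedValue_le hJ fun j hj => ?_
  have hi := hf.integrable_capped (μ := μ) hK hj.measurable hj.nonneg
  have h1 : ∫ ω, min K' (f ω (j ω)) ∂μ ≤ ∫ ω, (min K (f ω (j ω)) + (K' - K)) ∂μ := by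
    refine integral_mono (hf.integrable_capped (hK.trans hKK) hj.measurable hj.nonneg)
      (hi.add (integrable_const _)) fun ω => ?_
    simp only
    rcases le_total K (f ω (j ω)) with h | h
    · rw [min_eq_left h]
      linarith [min_le_left K' (f ω (j ω))]
    · rw [min_eq_right h]
      linarith [min_le_right K' (f ω (j ω))]
  rw [integral_add hi (integrable_const _)] at h1
  simp only [integral_const, probReal_univ, smul_eq_mul, one_mul] at h1
  linarith [hf.capped_le_value hK hj]

theorem IsCurveFamily.continuousOn_cappedValue (hf : IsCurveFamily f S a A b) (hJ : 0 < Jbar) :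
    ContinuousOn (cappedValue μ f Jbar) (Ici 0) := by
  have : LipschitzOnWith 1 (cappedValue μ f Jbar) (Ici 0) := by
    refine LipschitzOnWith.of_le_add fun x hx y hy => ?_
    rcases le_total x y with h | h
    · exact (hf.cappedValue_mono hJ hx h).trans (by linarith [dist_nonneg (x := x) (y := y)])
    · refine (hf.cappedValue_le_add hJ hy h).trans ?_
      rw [Real.dist_eq]
      linarith [le_abs_self (x - y)]
  exact this.continuousOn

theorem IsCurveFamily.cappedValue_le_level (hf : IsCurveFamily f S a A b) (hJ : 0 < Jbar)
    (hK : 0 ≤ K) : cappedValue μ f Jbar K ≤ K :=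
  cappedValue_le hJ fun _ hj => hf.capped_le_level hK hj

/-- The enforceable average grows sublinearly in the level. -/
theorem IsCurveFamily.exists_cappedValue_le_mul (hf : IsCurveFamily f S a A b) (hJ : 0 < Jbar)
    {η : ℝ} (hη : 0 < η) : ∃ K₁, 0 < K₁ ∧ ∀ K, K₁ ≤ K → cappedValue μ f Jbar K ≤ η * K := by
  have hlim : Tendsto (fun n : ℕ => μ.real {ω | S ω < 1 / ((n : ℝ) + 1)}) atTop (𝓝 0) := by
    have h1 := tendsto_measure_iInter_atTop (μ := μ) (s := fun n : ℕ => {ω | S ω < 1 / ((n : ℝ) + 1)})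
      (fun n => (measurableSet_lt hf.weight_measurable measurable_const).nullMeasurableSet)
      (fun m n hmn ω h => lt_of_lt_of_le (show S ω < _ from h) (Nat.one_div_le_one_div hmn)) ⟨0, measure_ne_top _ _⟩
    have h2 : ⋂ n : ℕ, {ω | S ω < 1 / ((n : ℝ) + 1)} = ∅ := by
      ext ω
      simp only [mem_iInter, mem_empty_iff_false, iff_false, not_forall]
      obtain ⟨n, hn⟩ := exists_nat_one_div_lt (hf.weight_pos ω)
      exact ⟨n, fun h => lt_asymm hn h⟩
    rw [h2, measure_empty] at h1
    exact (ENNReal.tendsto_toReal ENNReal.zero_ne_top).comp h1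
  -- Frames of weight below d have mass less than η/2 and contribute at most K each. On the others
  -- the curve is at most (A + b·j)/d, with average at most D, and D ≤ (η/2)·K once K ≥ 2D/η.
  obtain ⟨n, hn⟩ := (hlim.eventually_lt_const (half_pos hη)).exists
  set d : ℝ := 1 / ((n : ℝ) + 1) with hd
  have hd0 : 0 < d := by positivity
  have hA := hf.A_pos
  have hb := hf.b_pos
  let D : ℝ := (A + b * Jbar) / d
  have hD : 0 < D := by positivity
  refine ⟨2 * D / η, by positivity, fun K hK => cappedValue_le hJ fun j hj => ?_⟩
  have hK0 : 0 < K := lt_of_lt_of_le (by positivity) hK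
  have hset : MeasurableSet {ω | S ω < d} := measurableSet_lt hf.weight_measurable measurable_const
  have hi1 : Integrable (({ω | S ω < d}).indicator fun _ => K) μ :=
    (integrable_const K).indicator hset
  have hi2 : Integrable (fun ω => (A + b * j ω) / d) μ :=
    ((integrable_const A).add (hj.integrable.const_mul b)).div_const d
  have h1 : ∫ ω, min K (f ω (j ω)) ∂μ ≤
      ∫ ω, (({ω | S ω < d}).indicator (fun _ => K) ω + (A + b * j ω) / d) ∂μ := by
    refine integral_mono (hf.integrable_capped hK0.le hj.measurable hj.nonneg) (hi1.add hi2)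
      fun ω => ?_
    have hjω := hj.nonneg ω
    have h0 : 0 ≤ (A + b * j ω) / d := by positivity
    by_cases hω : S ω < d
    · simp only [indicator_of_mem (show ω ∈ {ω | S ω < d} from hω)]
      linarith [min_le_left K (f ω (j ω))]
    · simp only [indicator_of_notMem (show ω ∉ {ω | S ω < d} from hω), zero_add]
      refine (min_le_right _ _).trans ((hf.upper ω _ hjω).trans ?_)
      rw [not_lt] at hω
      gcongr
  rw [integral_add hi1 hi2, integral_indicator_const _ hset, integral_div,
    integral_add (integrable_const A) (hj.integrable.const_mul b), integral_const_mul] at h1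
  simp only [integral_const, probReal_univ, smul_eq_mul, one_mul] at h1
  have h2 : (A + b * ∫ ω, j ω ∂μ) / d ≤ D := by
    simp only [D]
    gcongr
    exact hj.integral_le
  have h3 : D ≤ η / 2 * K := by
    rw [div_le_iff₀ hη] at hK
    linarith
  have h4 := mul_le_mul_of_nonneg_right hn.le hK0.le
  linarith

omit [IsProbabilityMeasure μ] in
theorem IsFeasible.mono (hf : IsCurveFamily f S a A b) {K' : ℝ} (h : IsFeasible μ f Jbar K)
    (hKK : K ≤ K') : IsFeasible μ f Jbar K' :=
  ⟨h.1.trans_le hKK, h.2.trans (lintegral_mono fun ω => ENNReal.ofReal_le_ofReal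
    ((hf.reach_le_iff (hf.reach_spec K' ω).1).2 (hKK.trans (hf.reach_spec K' ω).2)))⟩

theorem IsCurveFamily.weight_mul_le (hf : IsCurveFamily f S a A b) (K : ℝ) (ω : Ω) :
    K * S ω ≤ A + b * reach f K ω := by
  have h1 := (hf.reach_spec K ω).2.trans (hf.upper ω _ (hf.reach_spec K ω).1)
  rwa [le_div_iff₀ (hf.weight_pos ω)] at h1

/-- Some set {S > d} has positive mass m. The level is chosen so that reaching it there takes at
least |Jbar|/m per frame, hence |Jbar| on average. -/
theorem IsCurveFamily.exists_feasible (hf : IsCurveFamily f S a A b) :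
    ∃ K, IsFeasible μ f Jbar K := by
  obtain ⟨n, hn⟩ : ∃ n : ℕ, μ {ω | 1 / ((n : ℝ) + 1) < S ω} ≠ 0 := by
    by_contra! hcon
    have h1 : ∀ᵐ ω ∂μ, ∀ n : ℕ, ¬ 1 / ((n : ℝ) + 1) < S ω :=
      ae_all_iff.2 fun n => by
        rw [ae_iff]
        simpa only [not_not] using hcon n
    obtain ⟨ω, hω⟩ := h1.exists
    obtain ⟨n, hn⟩ := exists_nat_one_div_lt (hf.weight_pos ω)
    exact hω n hn
  set d : ℝ := 1 / ((n : ℝ) + 1) with hd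
  have hd0 : 0 < d := by positivity
  have hA := hf.A_pos
  have hb := hf.b_pos
  set m := μ.real {ω | d < S ω} with hm
  have hm0 : 0 < m := ENNReal.toReal_pos hn (measure_ne_top _ _)
  refine ⟨(A + b * (|Jbar| / m)) / d, by positivity, ?_⟩
  have hset : MeasurableSet {ω | d < S ω} := measurableSet_lt measurable_const hf.weight_measurable
  calc ENNReal.ofReal Jbar ≤ ENNReal.ofReal (|Jbar| / m * m) := by
        rw [div_mul_cancel₀ _ hm0.ne']
        exact ENNReal.ofReal_le_ofReal (le_abs_self _)
    _ = ∫⁻ _ in {ω | d < S ω}, ENNReal.ofReal (|Jbar| / m) ∂μ := by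
        rw [setLIntegral_const, ENNReal.ofReal_mul (by positivity), hm, Measure.real,
          ENNReal.ofReal_toReal (measure_ne_top _ _)]
    _ ≤ ∫⁻ ω in {ω | d < S ω}, ENNReal.ofReal
          (reach f ((A + b * (|Jbar| / m)) / d) ω) ∂μ := by
        refine setLIntegral_mono' hset fun ω hω => ENNReal.ofReal_le_ofReal ?_
        have h1 := hf.weight_mul_le ((A + b * (|Jbar| / m)) / d) ω
        have h2 : A + b * (|Jbar| / m) ≤ (A + b * (|Jbar| / m)) / d * S ω := by
          rw [div_mul_eq_mul_div, le_div_iff₀ hd0]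
          exact mul_le_mul_of_nonneg_left (le_of_lt hω) (by positivity)
        have h3 : b * (|Jbar| / m) ≤ b * reach f ((A + b * (|Jbar| / m)) / d) ω := by linarith
        exact le_of_mul_le_mul_left h3 hb
    _ ≤ _ := setLIntegral_le_lintegral _ _

/-- If all curves can be lifted to `K` with power to spare, they can be lifted higher. -/
theorem IsCurveFamily.exists_higher_level (hf : IsCurveFamily f S a A b) (hJ : 0 < Jbar)
    (hK : 0 < K) (h : ¬ IsFeasible μ f Jbar K) :
    ∃ K', K < K' ∧ cappedValue μ f Jbar K' = K' := by
  have hlt : ∫⁻ ω, ENNReal.ofReal (reach f K ω) ∂μ < ENNReal.ofReal Jbar := by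
    by_contra! h'
    exact h ⟨hK, h'⟩
  have ha := hf.a_pos
  have hb := hf.b_pos
  have hA := hf.A_pos
  have hr0 : 0 ≤ᵐ[μ] reach f K := Eventually.of_forall fun ω => (hf.reach_spec K ω).1
  have hri : Integrable (reach f K) μ := by
    refine ⟨(hf.measurable_reach K).aestronglyMeasurable, ?_⟩
    rw [hasFiniteIntegral_iff_ofReal hr0]
    exact hlt.trans ENNReal.ofReal_lt_top
  have hr1 : ∫ ω, reach f K ω ∂μ < Jbar := by
    rw [← ofReal_integral_eq_lintegral_ofReal hri hr0] at hlt
    exact (ENNReal.ofReal_lt_ofReal_iff hJ).1 hlt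
  -- The weight is dominated by the integrable cost of reaching K. An extra power ε/a·S lifts every
  -- curve by at least ε, so the slack in the budget pays for a uniform rise.
  have hSi : Integrable S μ := by
    refine Integrable.mono' (((integrable_const A).add (hri.const_mul b)).div_const K)
      hf.weight_measurable.aestronglyMeasurable (Eventually.of_forall fun ω => ?_)
    rw [Real.norm_eq_abs, abs_of_pos (hf.weight_pos ω), le_div_iff₀ hK, mul_comm]
    exact hf.weight_mul_le K ω
  have hS0 : 0 ≤ ∫ ω, S ω ∂μ := integral_nonneg fun ω => (hf.weight_pos ω).le
  obtain ⟨ε, hε, hεJ⟩ : ∃ ε, 0 < ε ∧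
      ∫ ω, reach f K ω ∂μ + ε / a * ∫ ω, S ω ∂μ ≤ Jbar := by
    refine ⟨a * (Jbar - ∫ ω, reach f K ω ∂μ) / (∫ ω, S ω ∂μ + 1), ?_, ?_⟩
    · have := sub_pos.2 hr1
      positivity
    · have h2 : (∫ ω, S ω ∂μ) / ((∫ ω, S ω ∂μ) + 1) ≤ 1 := by
        rw [div_le_one (by positivity)]
        linarith
      have h1 : a * (Jbar - ∫ ω, reach f K ω ∂μ) / (∫ ω, S ω ∂μ + 1) / a * ∫ ω, S ω ∂μ =
          (Jbar - ∫ ω, reach f K ω ∂μ) * ((∫ ω, S ω ∂μ) / ((∫ ω, S ω ∂μ) + 1)) := by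
        field_simp
      rw [h1]
      have := mul_le_mul_of_nonneg_left h2 (sub_pos.2 hr1).le
      linarith
  let j : Ω → ℝ := fun ω => reach f K ω + ε / a * S ω
  have hji : Integrable j μ := hri.add (hSi.const_mul _)
  have hj : IsAllocation μ Jbar j := by
    refine ⟨(hf.measurable_reach K).add (hf.weight_measurable.const_mul _), fun ω => ?_, hji, ?_⟩
    · have h1 := (hf.reach_spec K ω).1
      have h2 := hf.weight_pos ω
      simp only [j]
      positivity
    · rw [integral_add hri (hSi.const_mul _), integral_const_mul]
      exact hεJ
  refine ⟨K + ε, by linarith, le_antisymm (hf.cappedValue_le_level hJ (by linarith)) ?_⟩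
  refine le_trans (le_of_eq ?_) (hf.capped_le_value (by linarith) hj)
  have : ∀ ω, min (K + ε) (f ω (j ω)) = K + ε := fun ω => by
    refine min_eq_left ?_
    have h2 := hf.weight_pos ω
    have h1 := hf.lower ω (reach f K ω) (ε / a * S ω) (hf.reach_spec K ω).1 (by positivity)
    have h3 : ε / a * S ω * (a / S ω) = ε := by field_simp
    have h4 := (hf.reach_spec K ω).2
    simp only [j]
    linarith
  simp [this]

end Value

/-! ### Spending the transmitter's budget on the cheapest frames -/

section Budget

variable {Ω : Type*} [MeasurableSpace Ω] {μ : Measure Ω} [IsProbabilityMeasure μ]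

/-- The cheapest points can be selected so as to spend a given budget exactly, when `μ` is
atomless along `X`. -/
theorem exists_cheapest_set {p X : Ω → ℝ} {B : ℝ} (hB : 0 < B) (hp : Measurable p)
    (hp0 : ∀ ω, 0 ≤ p ω) (hX : Measurable X) (hXn : ∀ t, μ {ω | X ω = t} = 0)
    (hbig : ENNReal.ofReal B < ∫⁻ ω, ENNReal.ofReal (p ω) ∂μ) :
    ∃ K, 0 < K ∧ ∃ A, MeasurableSet A ∧ (∀ ω ∈ A, p ω ≤ K) ∧ (∀ ω ∉ A, K ≤ p ω) ∧
      ∫ ω, A.indicator p ω ∂μ = B := by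
  have hind0 : ∀ (A : Set Ω) ω, 0 ≤ A.indicator p ω := fun A ω =>
    indicator_nonneg (fun ω _ => hp0 ω) ω
  have hindK : ∀ (A : Set Ω) {K : ℝ}, 0 ≤ K → (∀ ω ∈ A, p ω ≤ K) → ∀ ω, A.indicator p ω ≤ K :=
    fun A K hK h ω => by
      by_cases hω : ω ∈ A
      · rw [indicator_of_mem hω]
        exact h ω hω
      · rw [indicator_of_notMem hω]
        exact hK
  let L : ℝ → Set Ω := fun k => {ω | p ω ≤ k}
  have hL : ∀ k, MeasurableSet (L k) := fun k => measurableSet_le hp measurable_const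
  let T : ℝ → ℝ := fun k => ∫ ω, (L k).indicator p ω ∂μ
  have hint : ∀ (A : Set Ω) {K : ℝ}, MeasurableSet A → 0 ≤ K → (∀ ω ∈ A, p ω ≤ K) →
      Integrable (A.indicator p) μ := fun A K hA hK h =>
    integrable_of_bounds (hp.indicator hA) (hind0 A) (hindK A hK h)
  let C : Set ℝ := {k | 0 ≤ k ∧ B ≤ T k}
  have hCne : C.Nonempty := by
    have hlim : Tendsto (fun n : ℕ => ∫⁻ ω, ENNReal.ofReal ((L n).indicator p ω) ∂μ) atTop
        (𝓝 (∫⁻ ω, ENNReal.ofReal (p ω) ∂μ)) := by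
      refine lintegral_tendsto_of_tendsto_of_monotone
        (fun n => (hp.indicator (hL n)).ennreal_ofReal.aemeasurable)
        (Eventually.of_forall fun ω m n hmn => ENNReal.ofReal_le_ofReal ?_)
        (Eventually.of_forall fun ω => ?_)
      · refine indicator_le_indicator_of_subset (fun ω h => ?_) hp0 ω
        have h : p ω ≤ (m : ℝ) := h
        exact h.trans (by exact_mod_cast hmn)
      · obtain ⟨N, hN⟩ := exists_nat_ge (p ω)
        refine tendsto_const_nhds.congr' ?_
        filter_upwards [eventually_ge_atTop N] with n hn
        rw [indicator_of_mem]
        exact hN.trans (by exact_mod_cast hn)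
    obtain ⟨n, hn⟩ := (hlim.eventually_const_lt hbig).exists
    refine ⟨n, Nat.cast_nonneg n, ?_⟩
    rw [← ofReal_integral_eq_lintegral_ofReal (hint _ (hL n) (Nat.cast_nonneg n) fun ω h => h)
      (Eventually.of_forall (hind0 _))] at hn
    exact ((ENNReal.ofReal_lt_ofReal_iff_of_nonneg hB.le).1 hn).le
  have hCB : ∀ k ∈ C, B ≤ k := by
    intro k hk
    refine hk.2.trans ?_
    have := integral_mono (hint _ (hL k) hk.1 fun ω h => h) (integrable_const (μ := μ) k)
      (hindK (L k) hk.1 fun ω h => h)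
    simpa using this
  let K := sInf C
  have hKB : B ≤ K := le_csInf hCne hCB
  have hK : 0 < K := hB.trans_le hKB
  have hCbdd : BddBelow C := ⟨B, hCB⟩
  have hright : B ≤ T K := by
    let r : ℕ → ℝ := fun n => K + 1 / ((n : ℝ) + 1)
    have hrK : ∀ n, K < r n := fun n => lt_add_of_pos_right _ (by positivity)
    have hr1 : ∀ n, r n ≤ K + 1 := fun n => by
      have : 1 / ((n : ℝ) + 1) ≤ 1 := by
        rw [div_le_one (by positivity)]
        linarith [(Nat.cast_nonneg n : (0 : ℝ) ≤ n)]
      simp only [r]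
      linarith
    have hrlim : Tendsto r atTop (𝓝 K) := by
      simpa [r] using tendsto_one_div_add_atTop_nhds_zero_nat.const_add K
    refine ge_of_tendsto' (integral_tendsto_of_bounds (K := K + 1) (g := fun n => (L (r n)).indicator p)
      (fun n => hp.indicator (hL _)) (fun n => hind0 _)
      (fun n => hindK _ (by linarith) fun ω h => le_trans h (hr1 n)) fun ω => ?_) fun n => ?_
    · by_cases hω : p ω ≤ K
      · refine tendsto_const_nhds.congr fun n => ?_
        rw [indicator_of_mem (show ω ∈ L K from hω),
          indicator_of_mem (show ω ∈ L (r n) from hω.trans (hrK n).le)]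
      · rw [indicator_of_notMem (show ω ∉ L K from hω)]
        refine tendsto_const_nhds.congr' ?_
        filter_upwards [hrlim.eventually_lt_const (not_le.1 hω)] with n hn
        rw [indicator_of_notMem (show ω ∉ L (r n) from not_le.2 hn)]
    · obtain ⟨k, hk, hkr⟩ := exists_lt_of_csInf_lt hCne (hrK n)
      refine hk.2.trans (integral_mono (hint _ (hL k) hk.1 fun ω h => h)
        (hint _ (hL _) (hK.trans (hrK n)).le fun ω h => h) fun ω => ?_)
      exact indicator_le_indicator_of_subset (fun ω h => le_trans h hkr.le) hp0 ω
  let L' : Set Ω := {ω | p ω < K}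
  have hL' : MeasurableSet L' := measurableSet_lt hp measurable_const
  have hleft : ∫ ω, L'.indicator p ω ∂μ ≤ B := by
    let q : ℕ → ℝ := fun n => K - K / ((n : ℝ) + 1)
    have hqK : ∀ n, q n < K := fun n => sub_lt_self _ (by positivity)
    have hq0 : ∀ n, 0 ≤ q n := fun n => by
      have : K / ((n : ℝ) + 1) ≤ K := by
        rw [div_le_iff₀ (by positivity)]
        nlinarith [(Nat.cast_nonneg n : (0 : ℝ) ≤ n)]
      simp only [q]
      linarith
    have hqlim : Tendsto q atTop (𝓝 K) := by
      have h1 : Tendsto (fun n : ℕ => K / ((n : ℝ) + 1)) atTop (𝓝 0) :=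
        tendsto_const_nhds.div_atTop
          (tendsto_atTop_add_const_right _ _ tendsto_natCast_atTop_atTop)
      simpa [q] using h1.const_sub K
    refine le_of_tendsto' (integral_tendsto_of_bounds (K := K) (g := fun n => (L (q n)).indicator p)
      (fun n => hp.indicator (hL _)) (fun n => hind0 _)
      (fun n => hindK _ hK.le fun ω h => le_trans h (hqK n).le) fun ω => ?_) fun n => ?_
    · by_cases hω : p ω < K
      · rw [indicator_of_mem (show ω ∈ L' from hω)]
        refine tendsto_const_nhds.congr' ?_
        filter_upwards [hqlim.eventually_const_lt hω] with n hn
        rw [indicator_of_mem (show ω ∈ L (q n) from hn.le)]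
      · refine tendsto_const_nhds.congr fun n => ?_
        rw [indicator_of_notMem (show ω ∉ L' from hω), indicator_of_notMem
          (show ω ∉ L (q n) from not_le.2 ((hqK n).trans_le (not_lt.1 hω)))]
    · by_contra! h
      exact notMem_of_lt_csInf (hqK n) hCbdd ⟨hq0 n, h.le⟩
  rcases hleft.eq_or_lt with h | hleft
  · exact ⟨K, hK, L', hL', fun ω h => le_of_lt h, fun ω h => not_lt.1 h, h⟩
  rcases hright.eq_or_lt with h | hright
  · exact ⟨K, hK, L K, hL K, fun ω h => h, fun ω h => (not_le.1 h).le, h.symm⟩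
  -- The frames costing exactly K may have positive mass. They are admitted gradually along X, whose
  -- level sets are null, so the cost varies continuously from that of `L'` to that of `L K` and
  -- takes the value B.
  let A : ℝ → Set Ω := fun t => L' ∪ (L K ∩ {ω | X ω ≤ t})
  have hA : ∀ t, MeasurableSet (A t) := fun t =>
    hL'.union ((hL K).inter (measurableSet_le hX measurable_const))
  have hAK : ∀ t, ∀ ω ∈ A t, p ω ≤ K := by
    rintro t ω (h | h)
    · exact le_of_lt h
    · exact h.1
  have hcont : Continuous fun t => ∫ ω, (A t).indicator p ω ∂μ := by
    rw [continuous_iff_continuousAt]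
    intro t
    refine continuousAt_of_dominated (bound := fun _ => K)
      (Eventually.of_forall fun s => (hp.indicator (hA s)).aestronglyMeasurable)
      (Eventually.of_forall fun s => Eventually.of_forall fun ω => ?_) (integrable_const K) ?_
    · rw [Real.norm_eq_abs, abs_of_nonneg (hind0 _ ω)]
      exact hindK _ hK.le (hAK s) ω
    · have hne : ∀ᵐ ω ∂μ, X ω ≠ t := compl_mem_ae_iff.2 (hXn t)
      filter_upwards [hne] with ω hω
      rcases lt_or_gt_of_ne hω with h | h
      · refine (continuousAt_const (y := (A t).indicator p ω)).congr ?_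
        filter_upwards [Ioi_mem_nhds h] with s hs
        have : ω ∈ A t ↔ ω ∈ A s := by
          have h1 : X ω ≤ t := h.le
          have h2 : X ω ≤ s := le_of_lt hs
          simp [A, h1, h2]
        by_cases hm : ω ∈ A t
        · rw [indicator_of_mem hm, indicator_of_mem (this.1 hm)]
        · rw [indicator_of_notMem hm, indicator_of_notMem (mt this.2 hm)]
      · refine (continuousAt_const (y := (A t).indicator p ω)).congr ?_
        filter_upwards [Iio_mem_nhds h] with s hs
        have : ω ∈ A t ↔ ω ∈ A s := by
          have h1 : ¬ X ω ≤ t := not_le.2 h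
          have h2 : ¬ X ω ≤ s := not_le.2 hs
          simp [A, h1, h2]
        by_cases hm : ω ∈ A t
        · rw [indicator_of_mem hm, indicator_of_mem (this.1 hm)]
        · rw [indicator_of_notMem hm, indicator_of_notMem (mt this.2 hm)]
  have htop : Tendsto (fun n : ℕ => ∫ ω, (A n).indicator p ω ∂μ) atTop (𝓝 (T K)) := by
    refine integral_tendsto_of_bounds (K := K) (g := fun n : ℕ => (A n).indicator p)
      (fun n => hp.indicator (hA _)) (fun n => hind0 _) (fun n => hindK _ hK.le (hAK n)) fun ω => ?_
    refine tendsto_const_nhds.congr' ?_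
    obtain ⟨N, hN⟩ := exists_nat_ge (X ω)
    filter_upwards [eventually_ge_atTop N] with n hn
    have h1 : X ω ≤ n := hN.trans (by exact_mod_cast hn)
    by_cases hω : p ω ≤ K
    · rw [indicator_of_mem (show ω ∈ L K from hω),
        indicator_of_mem (show ω ∈ A n from Or.inr ⟨hω, h1⟩)]
    · rw [indicator_of_notMem (show ω ∉ L K from hω),
        indicator_of_notMem (show ω ∉ A n from fun h => hω (hAK n ω h))]
  have hbot : Tendsto (fun n : ℕ => ∫ ω, (A (-n)).indicator p ω ∂μ) atTop
      (𝓝 (∫ ω, L'.indicator p ω ∂μ)) := by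
    refine integral_tendsto_of_bounds (K := K) (g := fun n : ℕ => (A (-n)).indicator p)
      (fun n => hp.indicator (hA _)) (fun n => hind0 _) (fun n => hindK _ hK.le (hAK _)) fun ω => ?_
    refine tendsto_const_nhds.congr' ?_
    obtain ⟨N, hN⟩ := exists_nat_gt (-X ω)
    filter_upwards [eventually_ge_atTop N] with n hn
    have h1 : -X ω < n := hN.trans_le (by exact_mod_cast hn)
    by_cases hω : p ω < K
    · rw [indicator_of_mem (show ω ∈ L' from hω),
        indicator_of_mem (show ω ∈ A (-n) from Or.inl hω)]
    · rw [indicator_of_notMem (show ω ∉ L' from hω), indicator_of_notMem]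
      rintro (h | ⟨-, h⟩)
      · exact hω h
      · have h : X ω ≤ -n := h
        linarith
  obtain ⟨n, hn⟩ := (htop.eventually_const_lt hright).exists
  obtain ⟨m, hm⟩ := (hbot.eventually_lt_const hleft).exists
  obtain ⟨t, ht⟩ := mem_range_of_exists_le_of_exists_ge hcont ⟨_, hm.le⟩ ⟨_, hn.le⟩
  refine ⟨K, hK, A t, hA t, hAK t, fun ω h => ?_, ht⟩
  by_contra! hlt
  exact h (Or.inl hlt)

end Budget

/-! ### Duality between outage and capped power -/

section Game

variable {M : ℕ} {N R Pbar Jbar : ℝ} {μ : Measure (Fin M → ℝ)} [IsProbabilityMeasure μ]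

theorem measurableSet_outage {P J : (Fin M → ℝ) → Fin M → ℝ} (hP : Measurable P)
    (hJ : Measurable J) : MeasurableSet {h | mutualInfo N h (P h) (J h) < R} := by
  refine measurableSet_lt ?_ measurable_const
  unfold mutualInfo frameMean
  fun_prop

theorem isStrategy_zero (hP : 0 ≤ Pbar) : IsStrategy μ Pbar fun _ _ => 0 := by
  have : frameMean (fun _ : Fin M => (0 : ℝ)) = 0 := by simp [frameMean]
  exact ⟨measurable_const, fun _ _ => le_rfl, by simp [this], by simpa [this] using hP⟩

omit [IsProbabilityMeasure μ] in
theorem outage_nonneg (P J : (Fin M → ℝ) → Fin M → ℝ) : 0 ≤ outage μ N R P J :=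
  measureReal_nonneg

omit [IsProbabilityMeasure μ] in
theorem responseOutage_nonneg (J : (Fin M → ℝ) → Fin M → ℝ) :
    0 ≤ responseOutage μ N R Pbar J := by
  refine Real.sInf_nonneg ?_
  rintro _ ⟨P, -, rfl⟩
  exact outage_nonneg P J

omit [IsProbabilityMeasure μ] in
theorem responseOutage_le {P J : (Fin M → ℝ) → Fin M → ℝ} (hP : IsStrategy μ Pbar P) :
    responseOutage μ N R Pbar J ≤ outage μ N R P J := by
  refine csInf_le ⟨0, ?_⟩ ⟨P, hP, rfl⟩
  rintro _ ⟨P, -, rfl⟩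
  exact outage_nonneg P J

/-- Average over the frames of the required power capped at `K`. -/
noncomputable def cappedPower (μ : Measure (Fin M → ℝ)) (N R : ℝ) (J : (Fin M → ℝ) → Fin M → ℝ)
    (K : ℝ) : ℝ :=
  ∫ h, min K (requiredPower N R (regularize h) (J h)) ∂μ

variable (hM : 0 < M) (hN : 0 < N) (hR : 0 < R)

omit [IsProbabilityMeasure μ] in
include hM hN hR in
theorem measurable_requiredPower_regularize {J : (Fin M → ℝ) → Fin M → ℝ}
    (hJ : IsStrategy μ Jbar J) : Measurable fun h => requiredPower N R (regularize h) (J h) :=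
  measurable_requiredPower hM hN hR measurable_regularize regularize_pos hJ.measurable hJ.nonneg

include hM hN hR in
-- Weak duality: on each frame either there is an outage, charged K, or the transmitter pays at
-- least the required power.
theorem cappedPower_le_responseOutage (hP : 0 < Pbar) (hreg : ∀ᵐ h ∂μ, regularize h = h)
    {J : (Fin M → ℝ) → Fin M → ℝ} (hJ : IsStrategy μ Jbar J) {K : ℝ} (hK : 0 < K) :
    (cappedPower μ N R J K - Pbar) / K ≤ responseOutage μ N R Pbar J := by
  refine le_csInf ⟨_, _, isStrategy_zero hP.le, rfl⟩ ?_
  rintro _ ⟨P, hPs, rfl⟩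
  have hO := measurableSet_outage (N := N) (R := R) hPs.measurable hJ.measurable
  have hi : Integrable ({h | mutualInfo N h (P h) (J h) < R}.indicator fun _ => K) μ :=
    (integrable_const K).indicator hO
  have h1 : cappedPower μ N R J K ≤
      ∫ h, ({h | mutualInfo N h (P h) (J h) < R}.indicator (fun _ => K) h +
        frameMean (P h)) ∂μ := by
    refine integral_mono_ae (integrable_min hK.le (measurable_requiredPower_regularize hM hN hR hJ)
      fun _ => requiredPower_nonneg) (hi.add hPs.integrable) ?_
    filter_upwards [hreg] with h hh
    by_cases hout : mutualInfo N h (P h) (J h) < R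
    · simp only [indicator_of_mem (show h ∈ {h | mutualInfo N h (P h) (J h) < R} from hout)]
      have := frameMean_nonneg (hPs.nonneg h)
      linarith [min_le_left K (requiredPower N R (regularize h) (J h))]
    · simp only [indicator_of_notMem (show h ∉ {h | mutualInfo N h (P h) (J h) < R} from hout),
        zero_add]
      rw [hh]
      exact (min_le_right _ _).trans
        (requiredPower_le h (J h) (P h) (hPs.nonneg h) (not_lt.1 hout))
  rw [integral_add hi hPs.integrable, integral_indicator_const _ hO, smul_eq_mul] at h1
  have h2 := hPs.average_le
  rw [div_le_iff₀ hK]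
  unfold outage
  linarith

include hM hN hR in
-- If the average required power fits the budget, all frames are served. Otherwise the transmitter
-- serves a cheapest set `A` costing exactly Pbar; at its threshold K the capped power is Pbar +
-- K·μ(Aᶜ), and outage is confined to Aᶜ.
theorem responseOutage_le_cappedPower (hP : 0 < Pbar) (hdens : μ ≪ volume)
    (hreg : ∀ᵐ h ∂μ, regularize h = h)
    {J : (Fin M → ℝ) → Fin M → ℝ} (hJ : IsStrategy μ Jbar J) :
    responseOutage μ N R Pbar J = 0 ∨
      ∃ K, 0 < K ∧ responseOutage μ N R Pbar J ≤ (cappedPower μ N R J K - Pbar) / K := by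
  set p : (Fin M → ℝ) → ℝ := fun h => requiredPower N R (regularize h) (J h) with hp
  have hpm : Measurable p := measurable_requiredPower_regularize hM hN hR hJ
  have hp0 : ∀ h, 0 ≤ p h := fun h => requiredPower_nonneg
  obtain ⟨Q, hQ1, hQ2, hQ3, hQ4⟩ := exists_measurable_response hM hN hR
    (measurable_regularize (M := M)) regularize_pos hJ.measurable hJ.nonneg
  rcases le_or_gt (∫⁻ h, ENNReal.ofReal (p h) ∂μ) (ENNReal.ofReal Pbar) with hle | hgt
  · left
    have hpi : Integrable p μ := by
      refine ⟨hpm.aestronglyMeasurable, ?_⟩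
      rw [hasFiniteIntegral_iff_ofReal (Eventually.of_forall hp0)]
      exact hle.trans_lt ENNReal.ofReal_lt_top
    have hQs : IsStrategy μ Pbar Q := by
      refine ⟨hQ1, hQ2, by simpa only [hQ4] using hpi, ?_⟩
      simp only [hQ4]
      rw [← ofReal_integral_eq_lintegral_ofReal hpi (Eventually.of_forall hp0)] at hle
      exact (ENNReal.ofReal_le_ofReal_iff hP.le).1 hle
    refine le_antisymm ((responseOutage_le hQs).trans (le_of_eq ?_)) (responseOutage_nonneg J)
    have : μ {h | mutualInfo N h (Q h) (J h) < R} = 0 := by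
      refine compl_mem_ae_iff.1 ?_
      filter_upwards [hreg] with h hh
      have := hQ3 h
      rw [hh] at this
      exact not_lt.2 this.ge
    unfold outage
    rw [Measure.real, this, ENNReal.toReal_zero]
  · right
    have hX : ∀ t, μ {h : Fin M → ℝ | h ⟨0, hM⟩ = t} = 0 := fun t => by
      refine hdens ?_
      rw [volume_pi]
      exact Measure.pi_hyperplane (fun _ : Fin M => (volume : Measure ℝ)) ⟨0, hM⟩ t
    obtain ⟨K, hK, A, hA, hA1, hA2, hA3⟩ := exists_cheapest_set hP hpm hp0
      (measurable_pi_apply (⟨0, hM⟩ : Fin M)) hX hgt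
    refine ⟨K, hK, ?_⟩
    have hfr : ∀ h, frameMean (A.indicator Q h) = A.indicator p h := fun h => by
      by_cases hh : h ∈ A
      · rw [indicator_of_mem hh, indicator_of_mem hh]
        exact hQ4 h
      · rw [indicator_of_notMem hh, indicator_of_notMem hh]
        simp [frameMean]
    have hpi : Integrable (A.indicator p) μ := integrable_of_bounds (K := K) (hpm.indicator hA)
      (fun h => indicator_nonneg (fun h _ => hp0 h) h) fun h => by
        by_cases hh : h ∈ A
        · rw [indicator_of_mem hh]
          exact hA1 h hh
        · rw [indicator_of_notMem hh]
          exact hK.le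
    have hQs : IsStrategy μ Pbar (A.indicator Q) := by
      refine ⟨hQ1.indicator hA, fun h m => ?_, by simpa only [hfr] using hpi, ?_⟩
      · by_cases hh : h ∈ A
        · rw [indicator_of_mem hh]
          exact hQ2 h m
        · rw [indicator_of_notMem hh]
          rfl
      · simp only [hfr]
        exact hA3.le
    refine (responseOutage_le hQs).trans ?_
    have h1 : outage μ N R (A.indicator Q) J ≤ μ.real Aᶜ := by
      unfold outage
      refine ENNReal.toReal_mono (measure_ne_top _ _) (measure_mono_ae ?_)
      filter_upwards [hreg] with h hh hout hhA
      have h2 : mutualInfo N h (A.indicator Q h) (J h) < R := hout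
      rw [indicator_of_mem hhA] at h2
      have h3 := hQ3 h
      rw [hh] at h3
      exact h2.ne h3
    have h2 : cappedPower μ N R J K = Pbar + μ.real Aᶜ * K := by
      have h3 : ∀ h, min K (p h) = A.indicator p h + Aᶜ.indicator (fun _ => K) h := fun h => by
        by_cases hh : h ∈ A
        · rw [indicator_of_mem hh, indicator_of_notMem (notMem_compl_iff.2 hh), add_zero,
            min_eq_right (hA1 h hh)]
        · rw [indicator_of_notMem hh, indicator_of_mem (mem_compl hh), zero_add,
            min_eq_left (hA2 h hh)]
      have h4 : cappedPower μ N R J K = ∫ h, min K (p h) ∂μ := rfl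
      rw [h4, integral_congr_ae (Eventually.of_forall h3), integral_add hpi
        ((integrable_const K).indicator hA.compl), hA3, integral_indicator_const _ hA.compl,
        smul_eq_mul]
    rw [le_div_iff₀ hK, h2]
    have := mul_le_mul_of_nonneg_right h1 hK.le
    linarith

omit [IsProbabilityMeasure μ] in
include hM hN hR in
theorem requiredPower_regularize_le {J : (Fin M → ℝ) → Fin M → ℝ}
    (hJ : IsStrategy μ Jbar J) (h : Fin M → ℝ) :
    requiredPower N R (regularize h) (J h) ≤ charCurve N R (regularize h) (frameMean (J h)) :=
  requiredPower_le_charCurve hM hN hR (regularize_pos h) (hJ.nonneg h) le_rfl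

omit [IsProbabilityMeasure μ] in
theorem IsStrategy.isAllocation {J : (Fin M → ℝ) → Fin M → ℝ} (hJ : IsStrategy μ Jbar J) :
    IsAllocation μ Jbar fun h => frameMean (J h) :=
  ⟨measurable_frameMean.comp hJ.measurable, fun h => frameMean_nonneg (hJ.nonneg h),
    hJ.integrable, hJ.average_le⟩

include hM hN hR in
theorem cappedPower_le_cappedValue {J : (Fin M → ℝ) → Fin M → ℝ} (hJ : IsStrategy μ Jbar J)
    {K : ℝ} (hK : 0 ≤ K) : cappedPower μ N R J K ≤
      cappedValue μ (fun h => charCurve N R (regularize h)) Jbar K := by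
  have hf := isCurveFamily_charCurve hM hN hR
  refine le_trans ?_ (hf.capped_le_value hK hJ.isAllocation)
  exact integral_mono (integrable_min hK (measurable_requiredPower_regularize hM hN hR hJ)
    fun _ => requiredPower_nonneg)
    (hf.integrable_capped hK hJ.isAllocation.measurable hJ.isAllocation.nonneg)
    fun h => min_le_min_left K (requiredPower_regularize_le hM hN hR hJ h)

omit [IsProbabilityMeasure μ] in
/-- Steepest-slope fillings are the strategies that realize priced allocations. -/
theorem isSteepestFilling_iff (hM : 0 < M) (hN : 0 < N) (hR : 0 < R) (hJ0 : 0 < Jbar)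
    (hreg : ∀ᵐ h ∂μ, regularize h = h) {J : (Fin M → ℝ) → Fin M → ℝ}
    (hJ : IsStrategy μ Jbar J) {K : ℝ} :
    IsSteepestFilling μ N R Jbar K J ↔
      IsPricedAllocation μ (fun h => charCurve N R (regularize h)) K Jbar
        (fun h => frameMean (J h)) ∧
      ∀ᵐ h ∂μ, requiredPower N R (regularize h) (J h) =
        charCurve N R (regularize h) (frameMean (J h)) := by
  have hf := isCurveFamily_charCurve hM hN hR
  constructor
  · intro hF
    refine ⟨hf.pricedAllocation_of_steepest hJ0 hJ.isAllocation hF.average_eq ?_ ?_, ?_⟩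
    · filter_upwards [hreg, hF.level] with h hh h1
      rwa [hh]
    · filter_upwards [hreg, hF.steepest] with h₁ hh₁ h1
      filter_upwards [hreg, h1] with h₂ hh₂ h2
      rw [hh₁, hh₂]
      exact h2
    · filter_upwards [hreg, hF.intra] with h hh h1
      rwa [hh]
  · rintro ⟨hp, hi⟩
    refine ⟨hJ, hp.integral_eq, ?_, ?_, ?_⟩
    · filter_upwards [hreg, hi] with h hh h1
      rwa [hh] at h1
    · filter_upwards [hreg, hp.level] with h hh h1
      rwa [hh] at h1
    · filter_upwards [hreg, hp.steepest hf] with h₁ hh₁ h1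
      filter_upwards [hreg, h1] with h₂ hh₂ h2
      rw [hh₁, hh₂] at h2
      exact h2

theorem exists_steepestFilling (hM : 0 < M) (hN : 0 < N) (hR : 0 < R) (hJ0 : 0 < Jbar)
    (hreg : ∀ᵐ h ∂μ, regularize h = h) {K : ℝ}
    (hK : IsFeasible μ (fun h => charCurve N R (regularize h)) Jbar K) :
    ∃ J, IsSteepestFilling μ N R Jbar K J := by
  have hf := isCurveFamily_charCurve hM hN hR
  obtain ⟨j, hj⟩ := hf.exists_pricedAllocation hJ0 hK
  obtain ⟨J, h1, h2, h3, h4⟩ := exists_measurable_jamming hM hN hR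
    (measurable_regularize (M := M)) regularize_pos hj.allocation.measurable hj.allocation.nonneg
  have hJ : IsStrategy μ Jbar J := ⟨h1, h2, by simpa only [h3] using hj.allocation.integrable,
    by simpa only [h3] using hj.allocation.integral_le⟩
  refine ⟨J, (isSteepestFilling_iff hM hN hR hJ0 hreg hJ).2 ⟨by simpa only [h3] using hj, ?_⟩⟩
  exact Eventually.of_forall fun h => by rw [h3, h4]

theorem IsSteepestFilling.cappedPower_eq (hM : 0 < M) (hN : 0 < N) (hR : 0 < R) (hJ0 : 0 < Jbar)
    (hreg : ∀ᵐ h ∂μ, regularize h = h) {J : (Fin M → ℝ) → Fin M → ℝ} {K : ℝ} (hK : 0 < K)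
    (hJ : IsSteepestFilling μ N R Jbar K J) : cappedPower μ N R J K =
      cappedValue μ (fun h => charCurve N R (regularize h)) Jbar K := by
  have hf := isCurveFamily_charCurve hM hN hR
  obtain ⟨h1, h2⟩ := (isSteepestFilling_iff hM hN hR hJ0 hreg hJ.strategy).1 hJ
  rw [h1.cappedValue_eq hf hJ0 hK]
  refine integral_congr_ae ?_
  filter_upwards [h2] with h hh
  rw [hh]

/-- This is the uniqueness half of the allocation problem: attaining the capped value forces both
the common price and the optimal distribution inside frames. -/
theorem isSteepestFilling_of_cappedPower_ge (hM : 0 < M) (hN : 0 < N) (hR : 0 < R)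
    (hJ0 : 0 < Jbar) (hreg : ∀ᵐ h ∂μ, regularize h = h) {J : (Fin M → ℝ) → Fin M → ℝ} {K : ℝ}
    (hK : IsFeasible μ (fun h => charCurve N R (regularize h)) Jbar K)
    (hJ : IsStrategy μ Jbar J)
    (hge : cappedValue μ (fun h => charCurve N R (regularize h)) Jbar K ≤ cappedPower μ N R J K) :
    IsSteepestFilling μ N R Jbar K J := by
  have hf := isCurveFamily_charCurve hM hN hR
  obtain ⟨j, hj⟩ := hf.exists_pricedAllocation hJ0 hK
  rw [isSteepestFilling_iff hM hN hR hJ0 hreg hJ]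
  refine hj.of_capped_ge hf hK.1 hJ.isAllocation
    (measurable_requiredPower_regularize hM hN hR hJ) (fun _ => requiredPower_nonneg)
    (requiredPower_regularize_le hM hN hR hJ) (fun h h0 => ?_)
    (by rwa [hj.cappedValue_eq hf hJ0 hK.1] at hge)
  refine le_antisymm (requiredPower_regularize_le hM hN hR hJ h) ?_
  obtain ⟨L, hL0, hL, hL1⟩ := exists_charCurve_eq_requiredPower (N := N) (R := R) hM hN hR
    (regularize_pos h) (frameMean_nonneg (hJ.nonneg h))
  rw [hL1]
  refine requiredPower_mono hM hN hR (regularize_pos h) hL0 fun m => ?_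
  have := le_mul_frameMean hM hL0 m
  rw [hL, h0, mul_zero] at this
  exact this.trans (hJ.nonneg h m)

end Game

end Jamming

/-! ### Optimizing the level -/

theorem mainTheorem3 (M : ℕ) (hM : 0 < M) (N R Pbar Jbar : ℝ) (hN : 0 < N) (hR : 0 < R)
    (hP : 0 < Pbar) (hJ : 0 < Jbar)
    (μ : MeasureTheory.Measure (Fin M → ℝ)) [MeasureTheory.IsProbabilityMeasure μ]
    (hdens : μ.AbsolutelyContinuous MeasureTheory.volume)
    (hpos : ∀ᵐ h ∂μ, ∀ m, 0 ≤ h m) :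
    ∃ Kmax : ℝ, 0 < Kmax ∧
      -- some level in the compact interval is optimal, and its filling is an optimal strategy
      (∃ K ∈ Set.Icc 0 Kmax,
        (∃ J, Jamming.IsSteepestFilling μ N R Jbar K J) ∧
        ∀ J, Jamming.IsSteepestFilling μ N R Jbar K J →
          Jamming.IsOptimalJammer μ N R Pbar Jbar J) ∧
      -- unless no outage can be induced at all, every optimal strategy is of this form
      (∀ J, Jamming.IsOptimalJammer μ N R Pbar Jbar J →
        0 < Jamming.responseOutage μ N R Pbar J →
        ∃ K ∈ Set.Icc 0 Kmax, Jamming.IsSteepestFilling μ N R Jbar K J) ∧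
      -- exhaustive search over a fine enough finite grid gets within any accuracy of the optimum
      (∀ ε > 0, ∃ δ > 0, ∀ G : Finset ℝ, (∀ K ∈ G, K ∈ Set.Icc 0 Kmax) →
        (∀ x ∈ Set.Icc 0 Kmax, ∃ K ∈ G, |x - K| ≤ δ) →
        ∃ K ∈ G, (∃ J, Jamming.IsSteepestFilling μ N R Jbar K J) ∧
          ∀ J, Jamming.IsSteepestFilling μ N R Jbar K J →
            ∀ J', Jamming.IsStrategy μ Jbar J' →
              Jamming.responseOutage μ N R Pbar J' ≤
                Jamming.responseOutage μ N R Pbar J + ε) := by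
  have hreg := Jamming.ae_regularize_eq hdens hpos
  have hf := Jamming.isCurveFamily_charCurve hM hN hR
  set f : (Fin M → ℝ) → ℝ → ℝ := fun h => Jamming.charCurve N R (Jamming.regularize h) with hfdef
  set V : ℝ → ℝ := Jamming.cappedValue μ f Jbar with hV
  have hlow : ∀ J, Jamming.IsStrategy μ Jbar J → ∀ K, 0 < K →
      (Jamming.cappedPower μ N R J K - Pbar) / K ≤ Jamming.responseOutage μ N R Pbar J :=
    fun J hJs K hK => Jamming.cappedPower_le_responseOutage hM hN hR hP hreg hJs hK
  have hfill : ∀ J K, 0 < K → Jamming.IsSteepestFilling μ N R Jbar K J →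
      (V K - Pbar) / K ≤ Jamming.responseOutage μ N R Pbar J := fun J K hK hF => by
    have h1 := hlow J hF.strategy K hK
    rwa [hF.cappedPower_eq hM hN hR hJ hreg hK] at h1
  have hup : ∀ J, Jamming.IsStrategy μ Jbar J → Jamming.responseOutage μ N R Pbar J = 0 ∨
      ∃ K, 0 < K ∧ Jamming.responseOutage μ N R Pbar J ≤
        (Jamming.cappedPower μ N R J K - Pbar) / K := fun J hJs =>
    Jamming.responseOutage_le_cappedPower hM hN hR hP hdens hreg hJs
  have hcap : ∀ J, Jamming.IsStrategy μ Jbar J → ∀ K, 0 < K →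
      (Jamming.cappedPower μ N R J K - Pbar) / K ≤ (V K - Pbar) / K := fun J hJs K hK =>
    div_le_div_of_nonneg_right
      (sub_le_sub_right (Jamming.cappedPower_le_cappedValue hM hN hR hJs hK.le) _) hK.le
  -- The split is whether the jammer can force any outage at all.
  by_cases hcase : ∃ K₀, 0 < K₀ ∧ 0 < (V K₀ - Pbar) / K₀
  · obtain ⟨K₀, hK₀, hF₀⟩ := hcase
    obtain ⟨K₁, hK₁, hdecay⟩ := hf.exists_cappedValue_le_mul (μ := μ) hJ (half_pos hF₀)
    have hsmall : ∀ K, 0 < K → K < Pbar → (V K - Pbar) / K < 0 := fun K hK hKP => by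
      have := hf.cappedValue_le_level (μ := μ) hJ hK.le
      exact div_neg_of_neg_of_pos (by linarith) hK
    have hlarge : ∀ K, K₁ ≤ K → (V K - Pbar) / K < (V K₀ - Pbar) / K₀ := fun K hK => by
      have h1 := hdecay K hK
      have hK0 : 0 < K := hK₁.trans_le hK
      refine lt_of_le_of_lt ?_ (half_lt_self hF₀)
      rw [div_le_iff₀ hK0]
      linarith
    have hcont : ContinuousOn (fun K => (V K - Pbar) / K) (Set.Ioi 0) :=
      (((hf.continuousOn_cappedValue hJ).mono fun K hK => le_of_lt hK).sub
        continuousOn_const).div continuousOn_id fun K hK => ne_of_gt hK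
    have hK₀P : Pbar ≤ K₀ := by
      by_contra! h
      exact lt_asymm hF₀ (hsmall K₀ hK₀ h)
    have hK₀1 : K₀ ≤ K₁ := by
      by_contra! h
      exact lt_irrefl _ (hlarge K₀ h.le)
    obtain ⟨Ks, hKs, hmax⟩ := (isCompact_Icc (a := Pbar) (b := K₁)).exists_isMaxOn
      ⟨K₀, hK₀P, hK₀1⟩ (hcont.mono fun K hK => hP.trans_le hK.1)
    have hKs0 : 0 < Ks := hP.trans_le hKs.1
    have hopt : ∀ K, 0 < K → (V K - Pbar) / K ≤ (V Ks - Pbar) / Ks := fun K hK => by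
      have h0 : (V K₀ - Pbar) / K₀ ≤ (V Ks - Pbar) / Ks := hmax ⟨hK₀P, hK₀1⟩
      rcases lt_or_ge K Pbar with h | h
      · exact ((hsmall K hK h).trans hF₀).le.trans h0
      · rcases le_or_gt K K₁ with h' | h'
        · exact hmax ⟨h, h'⟩
        · exact (hlarge K h'.le).le.trans h0
    have hpos' : 0 < (V Ks - Pbar) / Ks := hF₀.trans_le (hopt K₀ hK₀)
    -- At an infeasible K some K' > K has V(K') = K', and 1 − Pbar/K' > 1 − Pbar/K ≥ (V(K) −
    -- Pbar)/K, so K is not a maximizer.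
    have hfeas : ∀ K, 0 < K → (V Ks - Pbar) / Ks ≤ (V K - Pbar) / K →
        Jamming.IsFeasible μ f Jbar K := fun K hK hge => by
      by_contra hnot
      obtain ⟨K', hKK', hV'⟩ := hf.exists_higher_level hJ hK hnot
      have hK' : 0 < K' := hK.trans hKK'
      have h1 := (hopt K' hK').trans hge
      have h2 := hf.cappedValue_le_level (μ := μ) hJ hK.le
      rw [hV, hV', div_le_div_iff₀ hK' hK] at h1
      have h3 := mul_le_mul_of_nonneg_right h2 hK'.le
      have h4 := mul_lt_mul_of_pos_left hKK' hP
      linarith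
    have hbound : ∀ J, Jamming.IsStrategy μ Jbar J →
        Jamming.responseOutage μ N R Pbar J ≤ (V Ks - Pbar) / Ks := fun J hJs => by
      rcases hup J hJs with h | ⟨K, hK, h⟩
      · rw [h]
        exact hpos'.le
      · exact h.trans ((hcap J hJs K hK).trans (hopt K hK))
    have hKsfeas := hfeas Ks hKs0 le_rfl
    obtain ⟨Js, hJs⟩ := Jamming.exists_steepestFilling hM hN hR hJ hreg hKsfeas
    -- The extra 1 leaves room for grid points to the right of `Ks`.
    refine ⟨K₁ + 1, by linarith, ⟨Ks, ⟨hKs0.le, hKs.2.trans (by linarith)⟩, ⟨Js, hJs⟩,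
      fun J hF => ⟨hF.strategy, fun J' hJ' => (hbound J' hJ').trans (hfill J Ks hKs0 hF)⟩⟩,
      fun J hJo hJpos => ?_, fun ε hε => ?_⟩
    · rcases hup J hJo.1 with h | ⟨K, hK, h⟩
      · exact absurd h hJpos.ne'
      · have h1 : (V Ks - Pbar) / Ks ≤ Jamming.responseOutage μ N R Pbar J :=
          (hfill Js Ks hKs0 hJs).trans (hJo.2 Js hJs.strategy)
        have h2 := h1.trans h
        have h3 := h2.trans (hcap J hJo.1 K hK)
        have hKK₁ : K ≤ K₁ := by
          by_contra! hlt
          exact lt_irrefl _ ((h3.trans_lt (hlarge K hlt.le)).trans_le (hopt K₀ hK₀))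
        refine ⟨K, ⟨hK.le, by linarith⟩, Jamming.isSteepestFilling_of_cappedPower_ge hM hN hR hJ
          hreg (hfeas K hK h3) hJo.1 ?_⟩
        -- The threshold K of the response to `J` is itself a maximizer, so `J` attains the capped
        -- value at K.
        have h4 := (hopt K hK).trans h2
        rw [div_le_div_iff_of_pos_right hK] at h4
        exact (sub_le_sub_iff_right _).1 h4
    · have hat : ∀ᶠ K in nhds Ks, (V Ks - Pbar) / Ks - ε < (V K - Pbar) / K :=
        (hcont.continuousAt (Ioi_mem_nhds hKs0)).eventually_const_lt (by linarith)
      obtain ⟨r, hr, hball⟩ := Metric.eventually_nhds_iff.1 hat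
      set δ := min (r / 3) (1 / 2) with hδ
      have hδ0 : 0 < δ := lt_min (by positivity) (by norm_num)
      have hδr : δ ≤ r / 3 := min_le_left _ _
      have hδ1 : δ ≤ 1 / 2 := min_le_right _ _
      refine ⟨δ, hδ0, fun G hG hnet => ?_⟩
      -- Aiming at `Ks + δ` puts the grid point in [Ks, Ks + 2δ]: not below `Ks`, hence feasible,
      -- and within r of it.
      obtain ⟨K, hKG, hK⟩ := hnet (Ks + δ) ⟨by linarith, by linarith [hKs.2]⟩
      obtain ⟨hK1, hK2⟩ := abs_le.1 hK
      have hK0 : 0 < K := by linarith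
      refine ⟨K, hKG, Jamming.exists_steepestFilling hM hN hR hJ hreg
        (hKsfeas.mono hf (by linarith)), fun J hF J' hJ' => ?_⟩
      have h1 := hball (y := K) (by rw [Real.dist_eq, abs_lt]; constructor <;> linarith)
      linarith [hbound J' hJ', hfill J K hK0 hF]
  · push Not at hcase
    have hzero : ∀ J, Jamming.IsStrategy μ Jbar J →
        Jamming.responseOutage μ N R Pbar J = 0 := fun J hJs => by
      rcases hup J hJs with h | ⟨K, hK, h⟩
      · exact h
      · exact le_antisymm (h.trans ((hcap J hJs K hK).trans (hcase K hK)))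
          (Jamming.responseOutage_nonneg J)
    obtain ⟨Ks, hKs⟩ := hf.exists_feasible (μ := μ) (Jbar := Jbar)
    have hKs0 : 0 < Ks := hKs.1
    refine ⟨Ks + 1, by linarith, ⟨Ks, ⟨hKs0.le, by linarith⟩,
      Jamming.exists_steepestFilling hM hN hR hJ hreg hKs,
      fun J hF => ⟨hF.strategy, fun J' hJ' => by rw [hzero J hF.strategy, hzero J' hJ']⟩⟩,
      fun J hJo hJpos => absurd (hzero J hJo.1) hJpos.ne',
      fun ε hε => ⟨1 / 2, by norm_num, fun G hG hnet => ?_⟩⟩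
    -- All strategies give zero outage here, so only feasibility matters, and any grid point at or
    -- above `Ks` has it.
    obtain ⟨K, hKG, hK⟩ := hnet (Ks + 1 / 2) ⟨by linarith, by linarith⟩
    obtain ⟨hK1, hK2⟩ := abs_le.1 hK
    refine ⟨K, hKG, Jamming.exists_steepestFilling hM hN hR hJ hreg
      (hKs.mono hf (by linarith)), fun J hF J' hJ' => ?_⟩
    rw [hzero J hF.strategy, hzero J' hJ']
    linarith
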